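/- **Setting.** Let $n\ge 2$, and let $H$ be an open subset of the unit torus $\mathbb T^n=\mathbb R^n/\mathbb Z^n$ with smooth boundary $\Sigma$ such that $Y_s=\mathbb T^n\setminus \overline H$ is connected (all objects on the torus are identified with $\mathbb Z^n$-periodic objects on $\mathbb R^n$). For a bounded domain $\Omega\subset\mathbb R^n$ with smooth boundary $\Gamma$ and $\varepsilon>0$ put $$\Omega_\varepsilon=\{x\in\Omega:\ x/\varepsilon\in Y_s\},\qquad \Sigma_\varepsilon=\{x\in\Omega:\ x/\varepsilon\in\Sigma\}.$$ Let $V_\varepsilon=\{v\in H^1(\Omega_\varepsilon): v=0 \text{ on }\Gamma\}$, that is, the set of limits in $H^1(\Omega_\varepsilon)$ of restrictions to $\Omega_\varepsilon$ of functions in $C_c^\infty(\Omega)$; on $\Sigma_\varepsilon$ the elements of $V_\varepsilon$ are understood in the sense of traces (the extension by continuity of the restriction of functions in $C_c^\infty(\Omega)$). Let $m,M,\mu_0>0$. Let $A=(a_{ij})\in C(\Omega;L^\infty_\#(Y))^{n\times n}$ (periodic in $y$, not necessarily symmetric) satisfy $m|\zeta|^2\le (A(x,y)\zeta,\zeta)\le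 M|\zeta|^2$ for all $\zeta\in\mathbb R^n$; let $\mu\in L^\infty(Y_s)$ be periodic with $\mu\ge\mu_0$ a.e. in $Y_s$; let $\alpha\in L^\infty(\Sigma)$ be periodic with $\int_\Sigma\alpha\,d\sigma=0$. Consider the bilinear form $$a_\varepsilon(u,v)=\int_{\Omega_\varepsilon}A\left(x,\tfrac x\varepsilon\right)\nabla u\cdot\nabla v\,dx+\int_{\Omega_\varepsilon}\mu\left(\tfrac x\varepsilon\right)uv\,dx+\int_{\Sigma_\varepsilon}\alpha\left(\tfrac x\varepsilon\right)uv\,d\sigma_\varepsilon .$$ **Lemma (coercivity of $a_\varepsilon$).** There is a constant $C_s>0$, depending only on $n$ and $H$ (in particular independent of $\varepsilon$, $\Omega$, $A$, $\mu$, $\alpha$), such that: 1. for every $\Omega$ and $\varepsilon>0$ as above, every $v\in V_\varepsilon$ has a trace in $L^2(\Sigma_\varepsilon)$, and for all $0<\delta\le 1$ $$\|v\|^2_{L^2(\Sigma_\varepsilon)}\le C_s\left[(\delta\varepsilon)^{-1}\|v\|^2_{L^2(\Omega_\varepsilon)}+\delta\varepsilon\,\|\nabla v\|^2_{L^2(\Omega_\varepsilon)^n}\right];$$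 2. for all $\Omega$, $m$, $M$, $\mu_0$, $A$, $\mu$, $\alpha$ as above, if $\sqrt{\mu_0 m}>C_s\|\alpha\|_{L^\infty(\Sigma)}$, then $$c_0:=\left(1-\frac{C_s\|\alpha\|_{L^\infty(\Sigma)}}{\sqrt{m\mu_0}}\right)\min(m,\mu_0)>0,$$ and for every $\varepsilon>0$ and every $v\in V_\varepsilon$ $$a_\varepsilon(v,v)\ \ge\ c_0\left[\|\nabla v\|^2_{L^2(\Omega_\varepsilon)^n}+\|v\|^2_{L^2(\Omega_\varepsilon)}\right].$$ Thus $a_\varepsilon$ is coercive on $V_\varepsilon$ with a constant $c_0$ independent of $\varepsilon$. -/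

import Mathlib

open MeasureTheory Filter Topology
open scoped ContDiff

noncomputable section

namespace Perforated

/-- `ℝⁿ` with its Euclidean structure. -/
abbrev Space (n : ℕ) : Type := EuclideanSpace ℝ (Fin n)

/-- The vector of `ℝⁿ` with integer coordinates `k`. -/
def intVec {n : ℕ} (k : Fin n → ℤ) : Space n := WithLp.toLp 2 (fun i => (k i : ℝ))

/-- The unit cell `[0,1)ⁿ`, a fundamental domain of the unit torus `ℝⁿ/ℤⁿ`. -/
def unitCell (n : ℕ) : Set (Space n) := {y | ∀ i, 0 ≤ y i ∧ y i < 1}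

/-- The projection of `ℝⁿ` onto the unit torus. -/
def toTorus {n : ℕ} (y : Space n) : Fin n → UnitAddCircle := fun i => (y i : UnitAddCircle)

/-- Sets of `ℝⁿ` that are invariant under integer translations. Subsets of the torus are
represented by such sets. -/
def IsPeriodicSet {n : ℕ} (P : Set (Space n)) : Prop :=
  ∀ (k : Fin n → ℤ) (y : Space n), y + intVec k ∈ P ↔ y ∈ P

/-- `f` is periodic of period `1` in each variable on the (periodic) set `P`. -/
def IsPeriodicOn {n : ℕ} {β : Type*} (f : Space n → β) (P : Set (Space n)) : Prop :=
  ∀ y ∈ P, ∀ k : Fin n → ℤ, f (y + intVec k) = f y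

/-- The open set `U` has a smooth boundary: near each boundary point, `U` is the set where a
smooth function with non-vanishing differential is negative. -/
def HasSmoothBoundary {n : ℕ} (U : Set (Space n)) : Prop :=
  IsOpen U ∧ ∀ x ∈ frontier U, ∃ (N : Set (Space n)) (ρ : Space n → ℝ),
    IsOpen N ∧ x ∈ N ∧ ContDiff ℝ ∞ ρ ∧ fderiv ℝ ρ x ≠ 0 ∧ ∀ y ∈ N, (y ∈ U ↔ ρ y < 0)

/-- The `(n-1)`-dimensional surface measure of `ℝⁿ`. -/
def surface (n : ℕ) : Measure (Space n) := Measure.euclideanHausdorffMeasure (n - 1)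

/-- The solid part `Y_s` of the torus (as a periodic set), for the periodic hole `P`. -/
def solid {n : ℕ} (P : Set (Space n)) : Set (Space n) := (closure P)ᶜ

/-- Lebesgue measure on one period of `Y_s`. -/
def solidMeasure {n : ℕ} (P : Set (Space n)) : Measure (Space n) :=
  volume.restrict (solid P ∩ unitCell n)

/-- Surface measure on one period of the boundary `Σ` of the hole. -/
def holeSurface {n : ℕ} (P : Set (Space n)) : Measure (Space n) :=
  (surface n).restrict (frontier P ∩ unitCell n)

/-- The perforated domain `Ω_ε`. -/
def perforated {n : ℕ} (Ω P : Set (Space n)) (ε : ℝ) : Set (Space n) :=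
  {x | x ∈ Ω ∧ ε⁻¹ • x ∈ solid P}

/-- The surface `Σ_ε`. -/
def holeBoundary {n : ℕ} (Ω P : Set (Space n)) (ε : ℝ) : Set (Space n) :=
  {x | x ∈ Ω ∧ ε⁻¹ • x ∈ frontier P}

/-- Smooth functions with compact support in `U`. -/
def IsTestFunction {n : ℕ} (U : Set (Space n)) (φ : Space n → ℝ) : Prop :=
  ContDiff ℝ ∞ φ ∧ HasCompactSupport φ ∧ tsupport φ ⊆ U

/-- `G ∈ L²(U)ⁿ` is the weak gradient of `v` in `U`. -/
def IsWeakGrad {n : ℕ} (U : Set (Space n)) (v : Space n → ℝ) (G : Space n → Space n) : Prop :=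
  MemLp G 2 (volume.restrict U) ∧
  ∀ φ, IsTestFunction U φ → ∀ i : Fin n,
    ∫ x in U, v x * gradient φ x i = - ∫ x in U, G x i * φ x

open Classical in
/-- The weak gradient of `v` in `U` (unique up to null sets; `0` if there is none). -/
def weakGrad {n : ℕ} (U : Set (Space n)) (v : Space n → ℝ) : Space n → Space n :=
  if h : ∃ G, IsWeakGrad U v G then h.choose else 0

/-- The Sobolev space `H¹(U)`. -/
def MemH1 {n : ℕ} (U : Set (Space n)) (v : Space n → ℝ) : Prop :=
  MemLp v 2 (volume.restrict U) ∧ ∃ G, IsWeakGrad U v G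

/-- The restrictions to `U` of the functions `φ k`, smooth and compactly supported in `Ω`,
converge to `v` in `H¹(U)`. -/
def Approximates {n : ℕ} (Ω U : Set (Space n)) (φ : ℕ → Space n → ℝ) (v : Space n → ℝ) : Prop :=
  (∀ k, IsTestFunction Ω (φ k)) ∧
  Tendsto (fun k => eLpNorm (fun x => φ k x - v x) 2 (volume.restrict U)) atTop (𝓝 0) ∧
  Tendsto (fun k => eLpNorm (fun x => gradient (φ k) x - weakGrad U v x) 2 (volume.restrict U))
    atTop (𝓝 0)

/-- The space `V_ε` of the functions of `H¹(Ω_ε)` that vanish on the boundary `Γ` of `Ω`: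
the limits in `H¹(Ω_ε)` of (restrictions of) smooth functions that vanish near `Γ`. -/
def MemV {n : ℕ} (Ω P : Set (Space n)) (ε : ℝ) (v : Space n → ℝ) : Prop :=
  MemH1 (perforated Ω P ε) v ∧ ∃ φ, Approximates Ω (perforated Ω P ε) φ v

/-- `g ∈ L²(Σ_ε)` is the trace of `v ∈ V_ε` on `Σ_ε`, the trace operator being the extension by
continuity of the restriction of smooth functions. -/
def IsTrace {n : ℕ} (Ω P : Set (Space n)) (ε : ℝ) (v g : Space n → ℝ) : Prop :=
  MemLp g 2 ((surface n).restrict (holeBoundary Ω P ε)) ∧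
  ∀ φ, Approximates Ω (perforated Ω P ε) φ v →
    Tendsto (fun k => eLpNorm (fun x => φ k x - g x) 2
      ((surface n).restrict (holeBoundary Ω P ε))) atTop (𝓝 0)

open Classical in
/-- The trace of `v ∈ V_ε` on `Σ_ε` (unique up to null sets; `0` if there is none). -/
def trace {n : ℕ} (Ω P : Set (Space n)) (ε : ℝ) (v : Space n → ℝ) : Space n → ℝ :=
  if h : ∃ g, IsTrace Ω P ε v g then h.choose else 0

/-- The squared norm of `v` in `L²(Ω_ε)`. -/
def normSq {n : ℕ} (Ω P : Set (Space n)) (ε : ℝ) (v : Space n → ℝ) : ℝ :=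
  ∫ x in perforated Ω P ε, v x ^ 2

/-- The squared norm of `∇v` in `L²(Ω_ε)ⁿ`. -/
def gradNormSq {n : ℕ} (Ω P : Set (Space n)) (ε : ℝ) (v : Space n → ℝ) : ℝ :=
  ∫ x in perforated Ω P ε, ‖weakGrad (perforated Ω P ε) v x‖ ^ 2

/-- The squared norm of (the trace of) `v` in `L²(Σ_ε)`. -/
def traceNormSq {n : ℕ} (Ω P : Set (Space n)) (ε : ℝ) (v : Space n → ℝ) : ℝ :=
  ∫ x in holeBoundary Ω P ε, trace Ω P ε v x ^ 2 ∂(surface n)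

/-- The bilinear expression `(M ζ, ξ)`. -/
def matForm {n : ℕ} (M : Matrix (Fin n) (Fin n) ℝ) (ζ ξ : Space n) : ℝ :=
  ∑ i, ∑ j, M i j * ζ j * ξ i

/-- The matrix field `A` belongs to `C(Ω; L^∞_#(Y))^{n×n}` and satisfies
`m|ζ|² ≤ (Aζ,ζ) ≤ M|ζ|²`. The exceptional null set of `y` in the last two fields does not depend on
`x`: an element of `C(Ω; L^∞_#(Y))` has such a representative, and `A(x, x/ε)` is then well defined
almost everywhere and measurable. -/
structure IsDiffusion {n : ℕ} (Ω : Set (Space n)) (m M : ℝ)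
    (A : Space n → Space n → Matrix (Fin n) (Fin n) ℝ) : Prop where
  periodic : ∀ x ∈ Ω, IsPeriodicOn (A x) Set.univ
  memLp : ∀ x ∈ Ω, ∀ i j, MemLp (fun y => A x y i j) ⊤ (volume.restrict (unitCell n))
  continuous : ∀ x₀ ∈ Ω, ∀ η > 0, ∃ r > 0, ∀ᵐ y ∂(volume : Measure (Space n)),
    ∀ x ∈ Ω, dist x x₀ < r → ∀ i j, |A x y i j - A x₀ y i j| ≤ η
  elliptic : ∀ᵐ y ∂(volume : Measure (Space n)), ∀ x ∈ Ω, ∀ ζ : Space n,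
    m * ‖ζ‖ ^ 2 ≤ matForm (A x y) ζ ζ ∧ matForm (A x y) ζ ζ ≤ M * ‖ζ‖ ^ 2

/-- `‖α‖_{L^∞(Σ)}`. -/
def supNorm {n : ℕ} (P : Set (Space n)) (α : Space n → ℝ) : ℝ :=
  (eLpNorm α ⊤ (holeSurface P)).toReal

/-- The bilinear form `a_ε` of the Robin problem. -/
def robinForm {n : ℕ} (Ω P : Set (Space n)) (A : Space n → Space n → Matrix (Fin n) (Fin n) ℝ)
    (μ α : Space n → ℝ) (ε : ℝ) (u v : Space n → ℝ) : ℝ :=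
  (∫ x in perforated Ω P ε,
      matForm (A x (ε⁻¹ • x)) (weakGrad (perforated Ω P ε) u x) (weakGrad (perforated Ω P ε) v x))
  + (∫ x in perforated Ω P ε, μ (ε⁻¹ • x) * u x * v x)
  + ∫ x in holeBoundary Ω P ε, α (ε⁻¹ • x) * trace Ω P ε u x * trace Ω P ε v x ∂(surface n)

end Perforated

end

open Perforated

namespace Perforated

open Set
open scoped ENNReal NNReal Pointwise

/-! The boundary term involves only the square of a function, and the square of an `H¹` function
lies in `W^{1,1}`. It therefore suffices to prove `L¹` estimates on one period. For a periodic `C¹`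
function `W`, `∫_Σ |W|` is bounded by `∫_{Y_s} |W| + |∇W|`, and for a suitable constant `c`, `∫_Σ |W
- c|` is bounded by `∫_{Y_s} |∇W|`. The second bound needs a single `c` for all of `Σ`, and this is
where connectedness of `Y_s` enters.

Both come from the relation `Linked` between measures: the double integral of `|W x - W y|` is at
most a constant times `∫_{Y_s} |∇W|`. A small ball is linked to itself (integrate along segments).
The relation is transitive through a nonzero finite measure, so it propagates through the connected
solid part (`linked_ball_of_isConnected`). A small boundary piece is a Lipschitz graph and is linked
to a ball by moving along a transversal direction (`exists_linked_boundary`). Compactness then links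
all of `Σ` to one ball (`exists_cell_bound`).

Given a test function `φ` on `Ω`, extended by zero, put `w y = φ (ε y) ^ 2` and apply these bounds
to the sum of the integer translates of `w`. Integrals over a period become integrals over all cells
at once, and cells cut by the boundary of `Ω` need no separate care. Since `α` has mean zero, `c`
can be subtracted: `∫ α W = ∫ α (W - c)`. Undoing the dilation, the trace bound keeps a term `ε⁻¹ ∫
φ²`, while the weighted integral is at most `C ‖α‖ ∫ 2 |φ| |∇φ|` with no power of `ε`
(`exists_scaled_bound`). Young's inequality gives both estimates for test functions, and density
carries them to `V_ε`.

For coercivity, Young's parameter is chosen so that the boundary term is at most the fraction `C ‖α‖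
/ √(m μ₀)` of `m ‖∇v‖² + μ₀ ‖v‖²`. -/

theorem enorm_sub_le_lintegral_fderiv {E : Type*} [NormedAddCommGroup E] [NormedSpace ℝ E]
    {W : E → ℝ} (hW : ContDiff ℝ 1 W) (x v : E) {a b : ℝ} (hab : a ≤ b) :
    ‖W (x + b • v) - W (x + a • v)‖ₑ
      ≤ ∫⁻ t in Ioc a b, ‖fderiv ℝ W (x + t • v)‖ₑ * ‖v‖ₑ := by
  have hcd : Continuous fun t : ℝ => fderiv ℝ W (x + t • v) v :=
    ((hW.continuous_fderiv (by simp)).comp (by fun_prop)).clm_apply continuous_const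
  have hd : ∀ t : ℝ, HasDerivAt (fun t : ℝ => W (x + t • v)) (fderiv ℝ W (x + t • v) v) t := by
    intro t
    have h1 : HasDerivAt (fun t : ℝ => x + t • v) v t := by
      simpa using ((hasDerivAt_id t).smul_const v).const_add x
    exact ((hW.differentiable (by simp) _).hasFDerivAt.comp_hasDerivAt t h1)
  rw [← intervalIntegral.integral_eq_sub_of_hasDerivAt (fun t _ => hd t)
    (hcd.intervalIntegrable a b), intervalIntegral.integral_of_le hab]
  refine (enorm_integral_le_lintegral_enorm _).trans (lintegral_mono fun t => ?_)
  exact ContinuousLinearMap.le_opENorm _ _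

/-! ### Unfolding of periodic sets and functions over the unit cell -/

section Cell

variable {n : ℕ}

@[simp] theorem intVec_apply (k : Fin n → ℤ) (i : Fin n) : intVec k i = (k i : ℝ) := rfl

theorem intVec_neg (k : Fin n → ℤ) : intVec (-k) = -intVec k := by
  ext i; simp

theorem intVec_add (k l : Fin n → ℤ) : intVec (k + l) = intVec k + intVec l := by
  ext i; simp

theorem measurableSet_unitCell : MeasurableSet (unitCell n) := by
  have : unitCell n = ⋂ i, {y : Space n | 0 ≤ y i} ∩ {y | y i < 1} := by
    ext y; simp [unitCell]
  rw [this]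
  refine MeasurableSet.iInter fun i => ?_
  exact (isClosed_le continuous_const (by fun_prop)).measurableSet.inter
    (isOpen_lt (by fun_prop) continuous_const).measurableSet

theorem add_intVec_mem_unitCell_iff (y : Space n) (k : Fin n → ℤ) :
    y + intVec k ∈ unitCell n ↔ k = fun i => -⌊y i⌋ := by
  constructor
  · intro h
    ext i
    have := h i
    simp only [PiLp.add_apply, intVec_apply] at this
    have : ⌊y i⌋ = -k i := by
      rw [Int.floor_eq_iff]
      push_cast
      constructor <;> linarith
    omega
  · rintro rfl i
    have h1 := Int.floor_le (y i)
    have h2 := Int.lt_floor_add_one (y i)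
    simp only [PiLp.add_apply, intVec_apply, Int.cast_neg]
    constructor <;> linarith

/-- The translates of the unit cell. -/
def cellAt (k : Fin n → ℤ) : Set (Space n) := (fun y => y + intVec k) ⁻¹' unitCell n

theorem measurableSet_cellAt (k : Fin n → ℤ) : MeasurableSet (cellAt k) :=
  measurableSet_unitCell.preimage (by fun_prop)

theorem iUnion_cellAt : ⋃ k, cellAt (n := n) k = univ := by
  refine eq_univ_of_forall fun y => mem_iUnion.2 ⟨fun i => -⌊y i⌋, ?_⟩
  exact (add_intVec_mem_unitCell_iff y _).2 rfl

theorem pairwise_disjoint_cellAt : Pairwise (Function.onFun Disjoint (cellAt (n := n))) := by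
  intro k l hkl
  refine disjoint_left.2 fun y hk hl => hkl ?_
  exact ((add_intVec_mem_unitCell_iff y k).1 hk).trans
    ((add_intVec_mem_unitCell_iff y l).1 hl).symm

theorem IsPeriodicSet.preimage_inter {Q : Set (Space n)} (hQ : IsPeriodicSet Q)
    (k : Fin n → ℤ) : (fun y => y + intVec k) ⁻¹' (Q ∩ unitCell n) = Q ∩ cellAt k := by
  ext y
  simp [cellAt, hQ k y]

/-- A measure that is invariant under integer translations. -/
def IntInvariant (ν : Measure (Space n)) : Prop :=
  ∀ k : Fin n → ℤ, MeasurePreserving (fun y => y + intVec k) ν ν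

theorem measurableEmbedding_add_intVec (k : Fin n → ℤ) :
    MeasurableEmbedding (fun y : Space n => y + intVec k) :=
  (Homeomorph.addRight (intVec k)).measurableEmbedding

theorem iUnion_inter_cellAt (Q : Set (Space n)) : ⋃ k, Q ∩ cellAt k = Q := by
  rw [← inter_iUnion, iUnion_cellAt, inter_univ]

/-- The sign of `k` is reversed because `cellAt k` is the unit cell shifted by `-k`. -/
theorem IntInvariant.setLIntegral_cellAt {ν : Measure (Space n)} (hν : IntInvariant ν)
    {Q : Set (Space n)} (hQ : IsPeriodicSet Q) (F : Space n → ℝ≥0∞) (k : Fin n → ℤ) :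
    ∫⁻ y in Q ∩ cellAt k, F y ∂ν = ∫⁻ y in Q ∩ unitCell n, F (y + intVec (-k)) ∂ν := by
  have h := (hν k).setLIntegral_comp_preimage_emb (measurableEmbedding_add_intVec k)
    (fun y => F (y + intVec (-k))) (Q ∩ unitCell n)
  simpa only [hQ.preimage_inter k, intVec_neg, add_neg_cancel_right] using h

theorem IntInvariant.setIntegral_cellAt {ν : Measure (Space n)} (hν : IntInvariant ν)
    {Q : Set (Space n)} (hQ : IsPeriodicSet Q) (F : Space n → ℝ) (k : Fin n → ℤ) :
    ∫ y in Q ∩ cellAt k, F y ∂ν = ∫ y in Q ∩ unitCell n, F (y + intVec (-k)) ∂ν := by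
  have h := (hν k).setIntegral_preimage_emb (measurableEmbedding_add_intVec k)
    (fun y => F (y + intVec (-k))) (Q ∩ unitCell n)
  simpa only [hQ.preimage_inter k, intVec_neg, add_neg_cancel_right] using h

/-- Unfolding of the integral over a periodic set. -/
theorem IntInvariant.setLIntegral_eq_tsum {ν : Measure (Space n)} (hν : IntInvariant ν)
    {Q : Set (Space n)} (hQ : IsPeriodicSet Q) (hQm : MeasurableSet Q) (F : Space n → ℝ≥0∞) :
    ∫⁻ y in Q, F y ∂ν = ∑' k, ∫⁻ y in Q ∩ unitCell n, F (y + intVec k) ∂ν := by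
  conv_lhs => rw [← iUnion_inter_cellAt Q]
  rw [lintegral_iUnion (fun k => hQm.inter (measurableSet_cellAt k))
    (fun k l h => (pairwise_disjoint_cellAt h).mono inter_subset_right inter_subset_right)]
  simp_rw [hν.setLIntegral_cellAt hQ]
  exact (Equiv.neg (Fin n → ℤ)).tsum_eq
    (fun k => ∫⁻ y in Q ∩ unitCell n, F (y + intVec k) ∂ν)

theorem IntInvariant.hasSum_setIntegral {ν : Measure (Space n)} (hν : IntInvariant ν)
    {Q : Set (Space n)} (hQ : IsPeriodicSet Q) (hQm : MeasurableSet Q) {F : Space n → ℝ}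
    (hF : IntegrableOn F Q ν) :
    HasSum (fun k => ∫ y in Q ∩ unitCell n, F (y + intVec k) ∂ν) (∫ y in Q, F y ∂ν) := by
  have h := hasSum_integral_iUnion (μ := ν) (f := F) (s := fun k => Q ∩ cellAt k)
    (fun k => hQm.inter (measurableSet_cellAt k))
    (fun k l h => (pairwise_disjoint_cellAt h).mono inter_subset_right inter_subset_right)
    (by rwa [iUnion_inter_cellAt])
  rw [iUnion_inter_cellAt] at h
  simp_rw [hν.setIntegral_cellAt hQ] at h
  exact (Equiv.neg (Fin n → ℤ)).hasSum_iff.1 (by simpa [Function.comp_def] using h)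

theorem IntInvariant.ae_restrict {ν : Measure (Space n)} (hν : IntInvariant ν)
    {Q : Set (Space n)} (hQ : IsPeriodicSet Q) (hQm : MeasurableSet Q) {p : Space n → Prop}
    (hp : ∀ y ∈ Q, ∀ k, p y → p (y + intVec k))
    (h : ∀ᵐ y ∂ν.restrict (Q ∩ unitCell n), p y) : ∀ᵐ y ∂ν.restrict Q, p y := by
  rw [← iUnion_inter_cellAt Q, ae_restrict_iUnion_iff]
  intro k
  rw [← hQ.preimage_inter k]
  have h2 := ((hν k).restrict_preimage_emb (measurableEmbedding_add_intVec k)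
    (Q ∩ unitCell n)).quasiMeasurePreserving.ae h
  filter_upwards [h2, ae_restrict_mem ((hQm.inter measurableSet_unitCell).preimage
    (measurableEmbedding_add_intVec k).measurable)] with y hy hy'
  have := hp _ hy'.1 (-k) hy
  simpa [intVec_neg] using this

theorem IntInvariant.aestronglyMeasurable {ν : Measure (Space n)} (hν : IntInvariant ν)
    {Q : Set (Space n)} (hQ : IsPeriodicSet Q) (hQm : MeasurableSet Q) {f : Space n → ℝ}
    (hf : IsPeriodicOn f Q) (h : AEStronglyMeasurable f (ν.restrict (Q ∩ unitCell n))) :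
    AEStronglyMeasurable f (ν.restrict Q) := by
  rw [← iUnion_inter_cellAt Q, aestronglyMeasurable_iUnion_iff]
  intro k
  rw [← hQ.preimage_inter k]
  have h2 := h.comp_measurePreserving ((hν k).restrict_preimage_emb
    (measurableEmbedding_add_intVec k) (Q ∩ unitCell n))
  refine h2.congr ?_
  filter_upwards [ae_restrict_mem ((hQm.inter measurableSet_unitCell).preimage
    (measurableEmbedding_add_intVec k).measurable)] with y hy
  exact hf y ((hQ k y).1 hy.1) k

theorem intInvariant_volume : IntInvariant (volume : Measure (Space n)) :=
  fun _ => measurePreserving_add_right _ _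

theorem intInvariant_surface : IntInvariant (surface n) :=
  fun k => (IsometryEquiv.addRight (intVec k)).measurePreserving_euclideanHausdorffMeasure _

theorem isPeriodicSet_univ : IsPeriodicSet (univ : Set (Space n)) := by
  intro k y; simp

theorem IsPeriodicSet.preimage_eq {Q : Set (Space n)} (hQ : IsPeriodicSet Q) (k : Fin n → ℤ) :
    (Homeomorph.addRight (intVec k)) ⁻¹' Q = Q := by
  ext y; exact hQ k y

theorem IsPeriodicSet.closure {Q : Set (Space n)} (hQ : IsPeriodicSet Q) :
    IsPeriodicSet (closure Q) := by
  intro k y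
  have := (Homeomorph.addRight (intVec k)).preimage_closure Q
  rw [hQ.preimage_eq] at this
  exact Set.ext_iff.1 this y

theorem IsPeriodicSet.frontier {Q : Set (Space n)} (hQ : IsPeriodicSet Q) :
    IsPeriodicSet (frontier Q) := by
  intro k y
  have := (Homeomorph.addRight (intVec k)).preimage_frontier Q
  rw [hQ.preimage_eq] at this
  exact Set.ext_iff.1 this y

theorem IsPeriodicSet.solid {Q : Set (Space n)} (hQ : IsPeriodicSet Q) :
    IsPeriodicSet (solid Q) := by
  intro k y
  exact not_congr (hQ.closure k y)

theorem isOpen_solid (P : Set (Space n)) : IsOpen (solid P) := isClosed_closure.isOpen_compl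

end Cell

/-! ### The boundary as a Lipschitz graph, and integration over tubes above it -/

section Graph

variable {m : ℕ}

/-- Forget the `i`-th coordinate. -/
def dropCoord (i : Fin (m + 1)) (y : Space (m + 1)) : Fin m → ℝ := fun j => y (i.succAbove j)

theorem continuous_dropCoord (i : Fin (m + 1)) : Continuous (dropCoord i) := by
  unfold dropCoord; fun_prop

theorem eq_single_add_sum (i : Fin (m + 1)) (w : Space (m + 1)) :
    w = w i • EuclideanSpace.single i (1 : ℝ)
      + ∑ j, dropCoord i w j • EuclideanSpace.single (i.succAbove j) (1 : ℝ) := by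
  have h := (EuclideanSpace.basisFun (Fin (m + 1)) ℝ).sum_repr w
  simp only [EuclideanSpace.basisFun_repr, EuclideanSpace.basisFun_apply] at h
  rw [Fin.sum_univ_succAbove _ i] at h
  exact h.symm

theorem norm_le_abs_add_dropCoord (i : Fin (m + 1)) (w : Space (m + 1)) :
    ‖w‖ ≤ |w i| + m * ‖dropCoord i w‖ := by
  conv_lhs => rw [eq_single_add_sum i w]
  refine (norm_add_le _ _).trans (add_le_add (by simp [norm_smul]) ?_)
  refine (norm_sum_le _ _).trans ?_
  refine (Finset.sum_le_card_nsmul _ _ ‖dropCoord i w‖ fun j _ => ?_).trans (by simp)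
  rw [norm_smul]
  simpa using norm_le_pi_norm (dropCoord i w) j

/-- A quantitative implicit function step: where `L` is small and its `i`-th partial derivative is
not, the `i`-th coordinate is controlled by the others. -/
theorem abs_mul_le_of_clm (i : Fin (m + 1)) (L : Space (m + 1) →L[ℝ] ℝ) (w : Space (m + 1)) :
    |L (EuclideanSpace.single i 1)| * |w i| ≤ |L w| + ‖L‖ * (m * ‖dropCoord i w‖) := by
  have h : L w = w i * L (EuclideanSpace.single i 1)
      + L (∑ j, dropCoord i w j • EuclideanSpace.single (i.succAbove j) (1 : ℝ)) := by
    conv_lhs => rw [eq_single_add_sum i w]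
    rw [map_add, map_smul, smul_eq_mul]
  have h2 : ‖∑ j, dropCoord i w j • EuclideanSpace.single (i.succAbove j) (1 : ℝ)‖
      ≤ m * ‖dropCoord i w‖ := by
    refine (norm_sum_le _ _).trans ?_
    refine (Finset.sum_le_card_nsmul _ _ ‖dropCoord i w‖ fun j _ => ?_).trans (by simp)
    rw [norm_smul]
    simpa using norm_le_pi_norm (dropCoord i w) j
  have h3 := (L.le_opNorm _).trans (mul_le_mul_of_nonneg_left h2 (norm_nonneg L))
  rw [Real.norm_eq_abs] at h3
  rw [mul_comm, ← abs_mul]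
  calc |w i * L (EuclideanSpace.single i 1)|
      = |L w - L (∑ j, dropCoord i w j • EuclideanSpace.single (i.succAbove j) (1 : ℝ))| := by
        rw [h]; congr 1; ring
    _ ≤ |L w| + _ := abs_sub _ _
    _ ≤ _ := by gcongr

theorem exists_single_ne_zero {L : Space (m + 1) →L[ℝ] ℝ} (hL : L ≠ 0) :
    ∃ i, L (EuclideanSpace.single i 1) ≠ 0 := by
  by_contra! h
  refine hL ?_
  ext w
  rw [eq_single_add_sum 0 w]
  simp [h]

/-- Near a boundary point, a smooth boundary is a Lipschitz graph over a coordinate hyperplane,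
with the complement of the closure on a fixed side of it. -/
theorem HasSmoothBoundary.exists_graph {P : Set (Space (m + 1))} (hP : HasSmoothBoundary P)
    {x₀ : Space (m + 1)} (hx₀ : x₀ ∈ frontier P) :
    ∃ (i : Fin (m + 1)) (a H r : ℝ) (K : ℝ≥0), a ≠ 0 ∧ 0 < H ∧ 0 < r ∧
      (∀ y ∈ frontier P ∩ Metric.closedBall x₀ r, ∀ t ∈ Ioc 0 H,
        y + t • EuclideanSpace.single i a ∈ solid P ∩ Metric.ball x₀ (1 / 4)) ∧
      ∀ y ∈ frontier P ∩ Metric.closedBall x₀ r, ∀ z ∈ frontier P ∩ Metric.closedBall x₀ r,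
        dist y z ≤ K * dist (dropCoord i y) (dropCoord i z) := by
  obtain ⟨hPo, hP⟩ := hP
  obtain ⟨N, ρ, hN, hxN, hρ, hρ', hNP⟩ := hP x₀ hx₀
  obtain ⟨i, hi⟩ := exists_single_ne_zero hρ'
  set L := fderiv ℝ ρ x₀ with hL
  set a := L (EuclideanSpace.single i 1) with ha
  have ha0 : 0 < |a| := abs_pos.2 hi
  have hstrict : HasStrictFDerivAt ρ L x₀ := hρ.contDiffAt.hasStrictFDerivAt (by simp)
  -- The error `|a| / 2` is half the size of the partial derivative `a`, so it can be absorbed both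
  -- in the growth of `ρ` along `a e_i` and in the Lipschitz estimate.
  obtain ⟨s, hs, happ⟩ := hstrict.approximates_deriv_on_nhds (c := Real.toNNReal (|a| / 2))
    (Or.inr (Real.toNNReal_pos.2 (half_pos ha0)))
  obtain ⟨R₀, hR₀, hR₀s⟩ := Metric.mem_nhds_iff.1 (Filter.inter_mem hs (hN.mem_nhds hxN))
  set R := min R₀ (1 / 4) with hR
  have hRpos : 0 < R := lt_min hR₀ (by norm_num)
  have hRs : ∀ y ∈ Metric.ball x₀ R, y ∈ s ∧ y ∈ N := fun y hy =>
    hR₀s (Metric.ball_subset_ball (min_le_left _ _) hy)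
  have hlin : ∀ y ∈ Metric.ball x₀ R, ∀ z ∈ Metric.ball x₀ R,
      |ρ y - ρ z - L (y - z)| ≤ |a| / 2 * ‖y - z‖ := fun y hy z hz =>
    by simpa [Real.coe_toNNReal _ (half_pos ha0).le] using happ y (hRs y hy).1 z (hRs z hz).1
  -- A negative value would put `y` in the open set `P`, which misses its frontier; a positive value
  -- persists nearby and would keep `y` out of the closure of `P`.
  have hzero : ∀ y ∈ Metric.ball x₀ R, y ∈ frontier P → ρ y = 0 := by
    intro y hy hyP
    rw [hPo.frontier_eq] at hyP
    have h1 : 0 ≤ ρ y := not_lt.1 fun h => hyP.2 ((hNP y (hRs y hy).2).2 h)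
    refine le_antisymm (not_lt.1 fun h => ?_) h1
    have hopen : IsOpen (N ∩ {z | 0 < ρ z}) :=
      hN.inter (isOpen_lt continuous_const hρ.continuous)
    obtain ⟨z, ⟨hzN, hz⟩, hzP⟩ := mem_closure_iff.1 hyP.1 _ hopen ⟨(hRs y hy).2, h⟩
    exact lt_asymm hz ((hNP z hzN).1 hzP)
  have hsolid : ∀ y ∈ Metric.ball x₀ R, 0 < ρ y → y ∈ solid P := by
    intro y hy h hyP
    have hopen : IsOpen (N ∩ {z | 0 < ρ z}) :=
      hN.inter (isOpen_lt continuous_const hρ.continuous)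
    obtain ⟨z, ⟨hzN, hz⟩, hzP⟩ := mem_closure_iff.1 hyP _ hopen ⟨(hRs y hy).2, h⟩
    exact lt_asymm hz ((hNP z hzN).1 hzP)
  have hsub : ∀ y ∈ frontier P ∩ Metric.closedBall x₀ (R / 2), y ∈ Metric.ball x₀ R :=
    fun y hy => Metric.closedBall_subset_ball (by linarith) hy.2
  -- The vector `t a e_i` has length at most `R / 4`, so starting within `R / 2` of `x₀` one stays
  -- in the ball of radius `R`. The direction carries the factor `a` so that `ρ` increases along it
  -- whatever the sign of `a`.
  refine ⟨i, a, R / (4 * |a|), R / 2,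
    ⟨m + 2 * (m * (‖L‖ + |a| / 2)) / |a|, by positivity⟩, hi, by positivity, by positivity,
    fun y hy t ht => ?_, fun y hy z hz => ?_⟩
  · have hyR := hsub y hy
    have hn : ‖t • EuclideanSpace.single i a‖ ≤ R / 4 := by
      rw [norm_smul, PiLp.norm_single, Real.norm_eq_abs, Real.norm_eq_abs,
        abs_of_pos ht.1]
      calc t * |a| ≤ R / (4 * |a|) * |a| := by gcongr; exact ht.2
        _ = R / 4 := by field_simp
    have hyt : y + t • EuclideanSpace.single i a ∈ Metric.ball x₀ R := by
      rw [Metric.mem_ball]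
      have h1 : dist y x₀ ≤ R / 2 := hy.2
      have h2 := dist_triangle (y + t • EuclideanSpace.single i a) y x₀
      have h3 : dist (y + t • EuclideanSpace.single i a) y ≤ R / 4 := by
        rw [dist_eq_norm]; simpa using hn
      linarith
    refine ⟨hsolid _ hyt ?_, Metric.ball_subset_ball (min_le_right _ _) hyt⟩
    have h1 := hlin _ hyt _ hyR
    rw [hzero y hyR hy.1, add_sub_cancel_left, sub_zero] at h1
    have h2 : L (t • EuclideanSpace.single i a) = t * a ^ 2 := by
      have : (EuclideanSpace.single i a : Space (m + 1)) = a • EuclideanSpace.single i 1 := by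
        ext j; by_cases h : j = i <;> simp [h]
      rw [this, map_smul, map_smul, ← ha, smul_eq_mul, smul_eq_mul]; ring
    rw [h2, norm_smul, PiLp.norm_single, Real.norm_eq_abs, Real.norm_eq_abs,
        abs_of_pos ht.1] at h1
    have h3 := (abs_le.1 h1).1
    have h4 : |a| / 2 * (t * |a|) = t * a ^ 2 / 2 := by rw [← sq_abs a]; ring
    have h5 : 0 < t * a ^ 2 := mul_pos ht.1 (by positivity)
    linarith
  · have hyR := hsub y hy
    have hzR := hsub z hz
    have h1 := hlin _ hyR _ hzR
    rw [hzero y hyR hy.1, hzero z hzR hz.1, sub_zero, zero_sub, abs_neg] at h1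
    have h2 := abs_mul_le_of_clm i L (y - z)
    have h3 := norm_le_abs_add_dropCoord i (y - z)
    have h4 : dist (dropCoord i y) (dropCoord i z) = ‖dropCoord i (y - z)‖ := by
      rw [dist_eq_norm]; rfl
    rw [h4, dist_eq_norm]
    change _ ≤ (m + 2 * (m * (‖L‖ + |a| / 2)) / |a|) * ‖dropCoord i (y - z)‖
    set d := ‖dropCoord i (y - z)‖
    -- On the frontier `|L (y - z)| ≤ |a| / 2 * ‖y - z‖`; half of `|a| * |(y - z) i|` is absorbed on
    -- the left.
    have h5 : |a| / 2 * |(y - z) i| ≤ m * (‖L‖ + |a| / 2) * d := by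
      have := mul_le_mul_of_nonneg_left h3 (by positivity : 0 ≤ |a| / 2)
      nlinarith
    have h6 : |(y - z) i| ≤ 2 * (m * (‖L‖ + |a| / 2)) / |a| * d := by
      rw [div_mul_eq_mul_div, le_div_iff₀ ha0]
      linarith
    linarith

/-- A `K`-Lipschitz map multiplies `m`-dimensional Hausdorff measure by at most `K ^ m`, and for the
sup metric on `Fin m → ℝ` that measure is Lebesgue measure. The Haar factor is the normalisation of
`Measure.euclideanHausdorffMeasure`. -/
theorem surface_image_le {g : (Fin m → ℝ) → Space (m + 1)} {K : ℝ≥0} {s : Set (Fin m → ℝ)}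
    (hg : LipschitzOnWith K g s) :
    ∃ C : ℝ≥0, ∀ t ⊆ s, surface (m + 1) (g '' t) ≤ C * volume t := by
  refine ⟨Measure.addHaarScalarFactor (volume : Measure (EuclideanSpace ℝ (Fin m)))
    (Measure.hausdorffMeasure m) * K ^ (m : ℝ), fun t ht => ?_⟩
  have h := (hg.mono ht).hausdorffMeasure_image_le (d := m) (by positivity)
  have h2 : (Measure.hausdorffMeasure (m : ℝ) : Measure (Fin m → ℝ)) = volume := by
    have := hausdorffMeasure_pi_real (ι := Fin m)
    simpa using this
  rw [h2] at h
  rw [surface, Nat.add_sub_cancel, Measure.euclideanHausdorffMeasure_def, Measure.smul_apply,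
    ENNReal.smul_def, smul_eq_mul, ENNReal.coe_mul, mul_assoc,
    ENNReal.coe_rpow_of_nonneg _ (by positivity)]
  gcongr

theorem lintegral_eq_lintegral_dropCoord (i : Fin (m + 1)) {F : Space (m + 1) → ℝ≥0∞}
    (hF : Measurable F) :
    ∫⁻ x, F x = ∫⁻ x' : Fin m → ℝ, ∫⁻ t : ℝ, F (WithLp.toLp 2 (i.insertNth t x')) := by
  have h1 := (PiLp.volume_preserving_toLp (Fin (m + 1))).lintegral_comp hF
  have h2 := (volume_preserving_piFinSuccAbove (fun _ => ℝ) i).symm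
  have hF' : Measurable fun y : Fin (m + 1) → ℝ => F (WithLp.toLp 2 y) :=
    hF.comp (PiLp.volume_preserving_toLp (Fin (m + 1))).measurable
  have h3 := hF'.comp h2.measurable
  rw [← h1, ← h2.lintegral_comp hF', Measure.volume_eq_prod]
  exact lintegral_prod_symm _ h3.aemeasurable

theorem lintegral_comp_add_mul (F : ℝ → ℝ≥0∞) {a : ℝ} (ha : a ≠ 0) (b : ℝ) :
    ∫⁻ t, F (b + t * a) = ENNReal.ofReal |a⁻¹| * ∫⁻ t, F t := by
  have h2 : ∫⁻ t, F (b + t * a) = ∫⁻ t, F (b + t) ∂(Measure.map (fun t => t * a) volume) :=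
    ((Homeomorph.mulRight₀ a ha).measurableEmbedding.lintegral_map (fun t => F (b + t))).symm
  rw [h2, Real.map_volume_mul_right ha, lintegral_smul_measure, smul_eq_mul,
    lintegral_add_left_eq_self]

/-- The tube over a Lipschitz graph swept by a coordinate vector has, up to a constant, at least
the product measure. -/
theorem exists_tube_le {S : Set (Space (m + 1))} (hS : IsCompact S) {i : Fin (m + 1)} {a H : ℝ}
    (ha : a ≠ 0) {K : ℝ≥0}
    (hK : ∀ y ∈ S, ∀ z ∈ S, dist y z ≤ K * dist (dropCoord i y) (dropCoord i z)) :
    ∃ C : ℝ≥0, surface (m + 1) S ≤ C ∧ ∀ U : Set (Space (m + 1)), MeasurableSet U →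
      (∀ y ∈ S, ∀ t ∈ Ioc 0 H, y + t • EuclideanSpace.single i a ∈ U) →
      ∀ F : Space (m + 1) → ℝ≥0∞, Measurable F →
        ∫⁻ y in S, (∫⁻ t in Ioc 0 H, F (y + t • EuclideanSpace.single i a)) ∂(surface (m + 1))
          ≤ C * ∫⁻ x in U, F x := by
  classical
  set π := dropCoord i
  set g := Function.invFunOn π S
  have hinj : InjOn π S := by
    intro y hy z hz h
    have := hK y hy z hz
    rw [show π y = π z from h, dist_self, mul_zero] at this
    exact dist_le_zero.1 this
  have hgπ : ∀ y ∈ S, g (π y) = y := fun y hy => hinj.leftInvOn_invFunOn hy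
  have hg : LipschitzOnWith K g (π '' S) := by
    refine LipschitzOnWith.of_dist_le_mul ?_
    rintro _ ⟨y, hy, rfl⟩ _ ⟨z, hz, rfl⟩
    rw [hgπ y hy, hgπ z hz]
    exact hK y hy z hz
  have hT : IsCompact (π '' S) := hS.image (continuous_dropCoord i)
  obtain ⟨C₁, hC₁⟩ := surface_image_le hg
  have hgm : AEMeasurable g (volume.restrict (π '' S)) :=
    hg.continuousOn.aemeasurable hT.measurableSet
  -- Surface measure on the graph is dominated by the image of Lebesgue measure on its projection;
  -- an upper bound is all that is needed, so no area formula is used.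
  have hle : (surface (m + 1)).restrict S
      ≤ (C₁ : ℝ≥0∞) • Measure.map g (volume.restrict (π '' S)) := by
    refine Measure.le_iff.2 fun E hE => ?_
    rw [Measure.restrict_apply hE, Measure.smul_apply, Measure.map_apply_of_aemeasurable hgm hE,
      smul_eq_mul]
    have h1 : E ∩ S = g '' (π '' (E ∩ S)) := by
      ext y
      constructor
      · exact fun hy => ⟨π y, ⟨y, hy, rfl⟩, hgπ y hy.2⟩
      · rintro ⟨_, ⟨z, hz, rfl⟩, rfl⟩
        rwa [hgπ z hz.2]
    rw [h1]
    refine (hC₁ _ (image_mono inter_subset_right)).trans ?_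
    refine mul_le_mul_right ((measure_mono ?_).trans (Measure.le_restrict_apply (π '' S) (g ⁻¹' E))) _
    rintro _ ⟨z, hz, rfl⟩
    exact ⟨by rw [mem_preimage, hgπ z hz.2]; exact hz.1, ⟨z, hz.2, rfl⟩⟩
  -- The first entry bounds the area of `S`, the second the tube integral; `|a⁻¹|` is the Jacobian
  -- of `t ↦ y i + t * a`.
  refine ⟨max (C₁ * (volume (π '' S)).toNNReal) (C₁ * Real.toNNReal |a⁻¹|), ?_, ?_⟩
  · have h1 := hC₁ _ subset_rfl
    have h2 : g '' (π '' S) = S := by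
      rw [image_image]
      exact (image_congr hgπ).trans (image_id' S)
    rw [h2] at h1
    refine h1.trans ?_
    rw [ENNReal.coe_max, ENNReal.coe_mul, ENNReal.coe_toNNReal hT.measure_lt_top.ne]
    exact le_max_left _ _
  intro U hU hSU F hF
  have hFU : Measurable (U.indicator F) := hF.indicator hU
  set f : Space (m + 1) → ℝ≥0∞ :=
    fun y => ∫⁻ t : ℝ, U.indicator F (y + t • EuclideanSpace.single i a) with hf
  have hfm : Measurable f :=
    Measurable.lintegral_prod_right'
      (f := fun p : Space (m + 1) × ℝ => U.indicator F (p.1 + p.2 • EuclideanSpace.single i a))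
      (hFU.comp (by fun_prop))
  calc ∫⁻ y in S, (∫⁻ t in Ioc 0 H, F (y + t • EuclideanSpace.single i a)) ∂(surface (m + 1))
      ≤ ∫⁻ y in S, f y ∂(surface (m + 1)) := by
        refine setLIntegral_mono' hS.measurableSet fun y hy => ?_
        rw [← lintegral_indicator measurableSet_Ioc]
        refine lintegral_mono fun t => ?_
        by_cases ht : t ∈ Ioc 0 H
        · rw [indicator_of_mem ht, indicator_of_mem (hSU y hy t ht)]
        · rw [indicator_of_notMem ht]; exact zero_le
    _ ≤ ∫⁻ y, f y ∂((C₁ : ℝ≥0∞) • Measure.map g (volume.restrict (π '' S))) :=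
        lintegral_mono' hle le_rfl
    _ = C₁ * ∫⁻ x' in π '' S, f (g x') := by
        rw [lintegral_smul_measure, lintegral_map' hfm.aemeasurable hgm, smul_eq_mul]
    -- Above a fixed projection the tube lies on a coordinate line, so shifting and rescaling `t`
    -- turns the inner integral into that of Fubini's theorem.
    _ ≤ C₁ * ∫⁻ x' in π '' S, ENNReal.ofReal |a⁻¹| *
          ∫⁻ t, U.indicator F (WithLp.toLp 2 (i.insertNth t x')) := by
        refine mul_le_mul_right (setLIntegral_mono' hT.measurableSet ?_) _
        rintro _ ⟨y, hy, rfl⟩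
        rw [hgπ y hy, ← lintegral_comp_add_mul _ ha (y i)]
        refine le_of_eq (lintegral_congr fun t => ?_)
        congr 1
        ext j
        refine Fin.succAboveCases i ?_ (fun j => ?_) j
        · simp
        · simp [π, dropCoord]
    _ ≤ C₁ * ∫⁻ x', ENNReal.ofReal |a⁻¹| *
          ∫⁻ t, U.indicator F (WithLp.toLp 2 (i.insertNth t x')) := by
        gcongr
        exact Measure.restrict_le_self
    _ = C₁ * (ENNReal.ofReal |a⁻¹| * ∫⁻ x in U, F x) := by
        rw [lintegral_const_mul' _ _ ENNReal.ofReal_ne_top,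
          ← lintegral_eq_lintegral_dropCoord i hFU, lintegral_indicator hU]
    _ ≤ _ := by
        rw [← mul_assoc]
        gcongr
        rw [ENNReal.coe_max, ENNReal.coe_mul]
        exact le_max_right _ _

end Graph

/-! ### Oscillation between measures, and its propagation through the solid part -/

section Linked

variable {n : ℕ}

/-- Continuously differentiable functions that are periodic of period one in each variable. -/
def IsPeriodicC1 (W : Space n → ℝ) : Prop := ContDiff ℝ 1 W ∧ IsPeriodicOn W univ

theorem IsPeriodicC1.continuous {W : Space n → ℝ} (hW : IsPeriodicC1 W) : Continuous W :=
  hW.1.continuous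

theorem IsPeriodicC1.measurable_enorm_fderiv {W : Space n → ℝ} (hW : IsPeriodicC1 W) :
    Measurable fun x => ‖fderiv ℝ W x‖ₑ :=
  (hW.1.continuous_fderiv (by simp)).enorm.measurable

theorem IsPeriodicC1.fderiv {W : Space n → ℝ} (hW : IsPeriodicC1 W) :
    IsPeriodicOn (fderiv ℝ W) univ := by
  intro y _ k
  have h : (fun x => W (x + intVec k)) = W := funext fun x => hW.2 x trivial k
  rw [← fderiv_comp_add_right, h]

/-- The integral of the length of the gradient over one period of the solid part. -/
noncomputable def cellGrad (P : Set (Space n)) (W : Space n → ℝ) : ℝ≥0∞ :=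
  ∫⁻ x in solid P ∩ unitCell n, ‖fderiv ℝ W x‖ₑ

/-- Points of a ball of radius `1 / 4` are less than `1 / 2` apart, so the ball embeds in the torus.
-/
theorem eq_of_add_intVec_mem_ball {x₀ y : Space n} {k l : Fin n → ℤ}
    (hk : y + intVec k ∈ Metric.ball x₀ (1 / 4)) (hl : y + intVec l ∈ Metric.ball x₀ (1 / 4)) :
    k = l := by
  ext i
  have h1 : ‖(y + intVec k) - (y + intVec l)‖ < 1 / 2 := by
    rw [← dist_eq_norm]
    have := dist_triangle_right (y + intVec k) (y + intVec l) x₀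
    rw [Metric.mem_ball] at hk hl
    linarith
  have h2 := (PiLp.norm_apply_le ((y + intVec k) - (y + intVec l)) i).trans_lt h1
  simp only [PiLp.sub_apply, intVec_apply, add_sub_add_left_eq_sub,
    Real.norm_eq_abs] at h2
  have h3 : |((k i - l i : ℤ) : ℝ)| < 1 := by push_cast; linarith
  rw [← Int.cast_abs] at h3
  have h4 : |k i - l i| < 1 := by exact_mod_cast h3
  exact sub_eq_zero.1 (Int.abs_lt_one_iff.1 h4)

/-- The integral of a periodic function over a small set is at most the one over a period. -/
theorem setLIntegral_le_cell {P U : Set (Space n)} (hP : IsPeriodicSet P) {x₀ : Space n}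
    (hU : MeasurableSet U) (hUP : U ⊆ solid P ∩ Metric.ball x₀ (1 / 4)) {F : Space n → ℝ≥0∞}
    (hF : Measurable F) (hFper : IsPeriodicOn F univ) :
    ∫⁻ x in U, F x ≤ ∫⁻ x in solid P ∩ unitCell n, F x := by
  have h1 : ∫⁻ x in U, F x = ∫⁻ x in solid P, U.indicator F x := by
    rw [setLIntegral_indicator hU, inter_eq_self_of_subset_left fun x hx => (hUP hx).1]
  have hm : ∀ k, AEMeasurable (fun y => U.indicator F (y + intVec k))
      (volume.restrict (solid P ∩ unitCell n)) := fun k =>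
    ((hF.indicator hU).comp (measurableEmbedding_add_intVec k).measurable).aemeasurable
  rw [h1, intInvariant_volume.setLIntegral_eq_tsum hP.solid (isOpen_solid P).measurableSet,
    ← lintegral_tsum (fun k => hm k)]
  refine lintegral_mono fun y => ?_
  -- At most one translate of `y` lies in `U`, so the unfolded sum has at most one nonzero term.
  by_cases h : ∃ k, y + intVec k ∈ U
  · obtain ⟨k, hk⟩ := h
    rw [tsum_eq_single k]
    · rw [indicator_of_mem hk, hFper y trivial k]
    · intro l hl
      refine indicator_of_notMem (fun hl' => hl ?_) _
      exact eq_of_add_intVec_mem_ball (hUP hl').2 (hUP hk).2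
  · push Not at h
    simp [indicator_of_notMem (h _)]

theorem setLIntegral_fderiv_le_cellGrad {P U : Set (Space n)} (hP : IsPeriodicSet P)
    {x₀ : Space n} (hU : MeasurableSet U) (hUP : U ⊆ solid P ∩ Metric.ball x₀ (1 / 4))
    {W : Space n → ℝ} (hW : IsPeriodicC1 W) :
    ∫⁻ x in U, ‖fderiv ℝ W x‖ₑ ≤ cellGrad P W :=
  setLIntegral_le_cell hP hU hUP hW.measurable_enorm_fderiv
    fun y hy k => by rw [hW.fderiv y hy k]

/-- The mean oscillation of periodic functions between the measures `ν` and `ν'` is controlled by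
their gradients. -/
def Linked (P : Set (Space n)) (ν ν' : Measure (Space n)) : Prop :=
  ∃ C : ℝ≥0∞, C ≠ ⊤ ∧ ∀ W, IsPeriodicC1 W →
    ∫⁻ x, ∫⁻ y, ‖W x - W y‖ₑ ∂ν' ∂ν ≤ C * cellGrad P W

variable {P : Set (Space n)} {ν ν' ν'' : Measure (Space n)}

theorem measurable_enorm_sub {W : Space n → ℝ} (hW : Continuous W) :
    Measurable (Function.uncurry fun x y : Space n => ‖W x - W y‖ₑ) :=
  Continuous.measurable (by fun_prop)

theorem Linked.symm [SFinite ν] [SFinite ν'] (h : Linked P ν ν') : Linked P ν' ν := by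
  obtain ⟨C, hC, h⟩ := h
  refine ⟨C, hC, fun W hW => ?_⟩
  rw [lintegral_lintegral_swap (measurable_enorm_sub hW.continuous).aemeasurable]
  simp_rw [enorm_sub_rev (W _) (W _)]
  exact h W hW

theorem Linked.mono {ν₁ ν₁' : Measure (Space n)} (h : Linked P ν ν') (h1 : ν₁ ≤ ν)
    (h2 : ν₁' ≤ ν') : Linked P ν₁ ν₁' := by
  obtain ⟨C, hC, h⟩ := h
  refine ⟨C, hC, fun W hW => le_trans ?_ (h W hW)⟩
  exact lintegral_mono' h1 fun x => lintegral_mono' h2 le_rfl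

theorem Linked.add {ν₁ : Measure (Space n)} (h : Linked P ν ν') (h1 : Linked P ν₁ ν') :
    Linked P (ν + ν₁) ν' := by
  obtain ⟨C, hC, h⟩ := h
  obtain ⟨C₁, hC₁, h1⟩ := h1
  refine ⟨C + C₁, ENNReal.add_ne_top.2 ⟨hC, hC₁⟩, fun W hW => ?_⟩
  rw [lintegral_add_measure, add_mul]
  exact add_le_add (h W hW) (h1 W hW)

/-- Compare `W x` and `W z` through `W y` and integrate over `y` with respect to `ν''`; dividing by
the total mass of `ν''` requires it to be nonzero and finite. -/
theorem Linked.trans [IsFiniteMeasure ν] [IsFiniteMeasure ν'] [IsFiniteMeasure ν'']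
    (h : Linked P ν ν'') (h' : Linked P ν'' ν') (h0 : ν'' ≠ 0) : Linked P ν ν' := by
  obtain ⟨C, hC, h⟩ := h
  obtain ⟨C', hC', h'⟩ := h'.symm
  have hu0 : ν'' univ ≠ 0 := by simpa using h0
  have hu : ν'' univ ≠ ⊤ := measure_ne_top _ _
  refine ⟨(ν'' univ)⁻¹ * (ν' univ * C + ν univ * C'), ?_, fun W hW => ?_⟩
  · refine ENNReal.mul_ne_top (ENNReal.inv_ne_top.2 hu0) (ENNReal.add_ne_top.2 ⟨?_, ?_⟩)
    · exact ENNReal.mul_ne_top (measure_ne_top _ _) hC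
    · exact ENNReal.mul_ne_top (measure_ne_top _ _) hC'
  have hm := measurable_enorm_sub hW.continuous
  have hA : Measurable fun x => ∫⁻ y, ‖W x - W y‖ₑ ∂ν'' := hm.lintegral_prod_right
  have key : ν'' univ * ∫⁻ x, ∫⁻ z, ‖W x - W z‖ₑ ∂ν' ∂ν
      ≤ (ν' univ * C + ν univ * C') * cellGrad P W := by
    calc ν'' univ * ∫⁻ x, ∫⁻ z, ‖W x - W z‖ₑ ∂ν' ∂ν
        = ∫⁻ x, ∫⁻ z, ν'' univ * ‖W x - W z‖ₑ ∂ν' ∂ν := by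
          rw [← lintegral_const_mul' _ _ hu]
          exact lintegral_congr fun x => (lintegral_const_mul' _ _ hu).symm
      _ = ∫⁻ x, ∫⁻ z, ∫⁻ _, ‖W x - W z‖ₑ ∂ν'' ∂ν' ∂ν := by
          simp only [lintegral_const, mul_comm]
      _ ≤ ∫⁻ x, ∫⁻ z, ∫⁻ y, (‖W x - W y‖ₑ + ‖W z - W y‖ₑ) ∂ν'' ∂ν' ∂ν := by
          refine lintegral_mono fun x => lintegral_mono fun z => lintegral_mono fun y => ?_
          have : W x - W z = (W x - W y) - (W z - W y) := by ring
          rw [this]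
          exact enorm_sub_le
      _ = ∫⁻ x, ∫⁻ z, ((∫⁻ y, ‖W x - W y‖ₑ ∂ν'') + ∫⁻ y, ‖W z - W y‖ₑ ∂ν'') ∂ν' ∂ν := by
          refine lintegral_congr fun x => lintegral_congr fun z => ?_
          exact lintegral_add_left (hm.comp measurable_prodMk_left) _
      _ = ν' univ * (∫⁻ x, ∫⁻ y, ‖W x - W y‖ₑ ∂ν'' ∂ν)
            + ν univ * ∫⁻ z, ∫⁻ y, ‖W z - W y‖ₑ ∂ν'' ∂ν' := by
          simp only [lintegral_add_left measurable_const, lintegral_const]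
          rw [lintegral_add_right _ measurable_const, lintegral_const, lintegral_mul_const _ hA,
            mul_comm, mul_comm (ν univ)]
      _ ≤ ν' univ * (C * cellGrad P W) + ν univ * (C' * cellGrad P W) := by
          gcongr
          · exact h W hW
          · exact h' W hW
      _ = _ := by ring
  rw [mul_assoc, mul_comm, ← div_eq_mul_inv, ENNReal.le_div_iff_mul_le (Or.inl hu0) (Or.inl hu),
    mul_comm]
  exact key

/-- Integrate the fundamental theorem of calculus along `x + t h` and exchange the integrals: for
each `t` the translate of `B` lies in `U`, which is small enough for the gradient over it to be
bounded by one period. -/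
theorem lintegral_translate_sub_le (hP : IsPeriodicSet P) {B U : Set (Space n)} {x₀ h : Space n}
    (hB : MeasurableSet B) (hU : MeasurableSet U)
    (hUP : U ⊆ solid P ∩ Metric.ball x₀ (1 / 4))
    (hBU : ∀ x ∈ B, ∀ t ∈ Ioc (0 : ℝ) 1, x + t • h ∈ U) {W : Space n → ℝ}
    (hW : IsPeriodicC1 W) :
    ∫⁻ x in B, ‖W (x + h) - W x‖ₑ ≤ ‖h‖ₑ * cellGrad P W := by
  have hm : Measurable fun p : Space n × ℝ => ‖fderiv ℝ W (p.1 + p.2 • h)‖ₑ * ‖h‖ₑ :=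
    (hW.measurable_enorm_fderiv.comp (by fun_prop : Measurable fun p : Space n × ℝ =>
      p.1 + p.2 • h)).mul_const _
  calc ∫⁻ x in B, ‖W (x + h) - W x‖ₑ
      ≤ ∫⁻ x in B, ∫⁻ t in Ioc (0 : ℝ) 1, ‖fderiv ℝ W (x + t • h)‖ₑ * ‖h‖ₑ := by
        refine lintegral_mono fun x => ?_
        simpa using enorm_sub_le_lintegral_fderiv hW.1 x h zero_le_one
    _ = ∫⁻ t in Ioc (0 : ℝ) 1, ∫⁻ x in B, ‖fderiv ℝ W (x + t • h)‖ₑ * ‖h‖ₑ :=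
        lintegral_lintegral_swap hm.aemeasurable
    _ ≤ ∫⁻ _ in Ioc (0 : ℝ) 1, ‖h‖ₑ * cellGrad P W := by
        refine setLIntegral_mono' measurableSet_Ioc fun t ht => ?_
        rw [lintegral_mul_const' _ _ enorm_ne_top, mul_comm]
        refine mul_le_mul_right ?_ _
        refine le_trans ?_ (setLIntegral_fderiv_le_cellGrad hP hU hUP hW)
        rw [← lintegral_indicator hB, ← lintegral_indicator hU,
          ← lintegral_add_right_eq_self (U.indicator _) (t • h)]
        refine lintegral_mono fun x => ?_
        by_cases hx : x ∈ B
        · rw [indicator_of_mem hx, indicator_of_mem (hBU x hx t ht)]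
        · rw [indicator_of_notMem hx]; exact zero_le
    _ = _ := by simp

/-- The ball of radius `r` about `x` is well inside the solid part. -/
def IsInnerBall (P : Set (Space n)) (x : Space n) (r : ℝ) : Prop :=
  0 < r ∧ 3 * r ≤ 1 / 4 ∧ Metric.ball x (3 * r) ⊆ solid P

theorem IsInnerBall.subset {x : Space n} {r : ℝ} (h : IsInnerBall P x r) :
    Metric.ball x (3 * r) ⊆ solid P ∩ Metric.ball x (1 / 4) :=
  subset_inter h.2.2 (Metric.ball_subset_ball h.2.1)

theorem exists_isInnerBall {x : Space n} (hx : x ∈ solid P) : ∃ r, IsInnerBall P x r := by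
  obtain ⟨R, hR, h⟩ := Metric.isOpen_iff.1 (isOpen_solid P) x hx
  refine ⟨min R (1 / 4) / 3, div_pos (lt_min hR (by norm_num)) three_pos, ?_, ?_⟩
  · have := min_le_right R (1 / 4)
    linarith
  · refine (Metric.ball_subset_ball ?_).trans h
    have := min_le_left R (1 / 4)
    linarith

/-- Two points of the ball differ by a vector shorter than `2r`, and translating the ball by
fractions of such a vector stays within radius `3r`. This is the reason for the factor 3 in
`IsInnerBall`. -/
theorem IsInnerBall.linked (hP : IsPeriodicSet P) {x : Space n} {r : ℝ}
    (h : IsInnerBall P x r) :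
    Linked P (volume.restrict (Metric.ball x r)) (volume.restrict (Metric.ball x r)) := by
  set B := Metric.ball x r
  set D := Metric.ball (0 : Space n) (2 * r)
  refine ⟨volume D * ENNReal.ofReal (2 * r),
    ENNReal.mul_ne_top measure_ball_lt_top.ne ENNReal.ofReal_ne_top, fun W hW => ?_⟩
  have hm : Measurable (Function.uncurry fun y z : Space n => ‖W (y + z) - W y‖ₑ) := by
    have := hW.continuous
    exact Continuous.measurable (by fun_prop)
  calc ∫⁻ y in B, ∫⁻ z in B, ‖W y - W z‖ₑ
      ≤ ∫⁻ y in B, ∫⁻ z in D, ‖W (y + z) - W y‖ₑ := by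
        refine setLIntegral_mono' measurableSet_ball fun y hy => ?_
        rw [← lintegral_indicator measurableSet_ball, ← lintegral_indicator measurableSet_ball,
          ← lintegral_add_left_eq_self _ y]
        refine lintegral_mono fun z => ?_
        by_cases hz : y + z ∈ B
        · have hzD : z ∈ D := by
            rw [mem_ball_zero_iff]
            have h1 := dist_triangle_right (y + z) y x
            rw [dist_eq_norm, add_sub_cancel_left] at h1
            have h2 : dist y x < r := hy
            have h3 : dist (y + z) x < r := hz
            linarith
          rw [indicator_of_mem hz, indicator_of_mem hzD, enorm_sub_rev]
        · rw [indicator_of_notMem hz]; exact zero_le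
    _ = ∫⁻ z in D, ∫⁻ y in B, ‖W (y + z) - W y‖ₑ := lintegral_lintegral_swap hm.aemeasurable
    _ ≤ ∫⁻ _ in D, ENNReal.ofReal (2 * r) * cellGrad P W := by
        refine setLIntegral_mono' measurableSet_ball fun z hz => ?_
        rw [mem_ball_zero_iff] at hz
        refine (lintegral_translate_sub_le hP measurableSet_ball measurableSet_ball h.subset
          (fun y hy t ht => ?_) hW).trans (mul_le_mul_left ?_ _)
        · rw [Metric.mem_ball] at hy ⊢
          have h1 := dist_triangle (y + t • z) y x
          rw [dist_eq_norm (y + t • z) y, add_sub_cancel_left, norm_smul, Real.norm_eq_abs,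
            abs_of_pos ht.1] at h1
          nlinarith [ht.2, norm_nonneg z]
        · rw [← ofReal_norm]
          exact ENNReal.ofReal_le_ofReal hz.le
    _ = _ := by
        rw [lintegral_const, Measure.restrict_apply_univ]
        ring

theorem restrict_ball_ne_zero (x : Space n) {r : ℝ} (hr : 0 < r) :
    (volume : Measure (Space n)).restrict (Metric.ball x r) ≠ 0 := by
  rw [Ne, Measure.restrict_eq_zero]
  exact (Metric.measure_ball_pos _ _ hr).ne'

instance isFiniteMeasure_restrict_ball (x : Space n) (r : ℝ) :
    IsFiniteMeasure ((volume : Measure (Space n)).restrict (Metric.ball x r)) :=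
  ⟨by rw [Measure.restrict_apply_univ]; exact measure_ball_lt_top⟩

theorem isOpenMap_toTorus : IsOpenMap (toTorus (n := n)) := by
  have h1 : IsOpenMap fun (y : Fin n → ℝ) (i : Fin n) => ((y i : ℝ) : UnitAddCircle) :=
    IsOpenMap.piMap (fun _ => QuotientAddGroup.isOpenMap_coe) (by simp)
  exact h1.comp (PiLp.homeomorph 2 (fun _ : Fin n => ℝ)).isOpenMap

theorem toTorus_eq_iff {x y : Space n} : toTorus x = toTorus y ↔ ∃ k, x = y + intVec k := by
  constructor
  · intro h
    have h1 : ∀ i, ∃ k : ℤ, x i - y i = k := fun i => by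
      have := congrFun h i
      obtain ⟨k, hk⟩ := AddSubgroup.mem_zmultiples_iff.1 (QuotientAddGroup.eq_iff_sub_mem.1 this)
      exact ⟨k, by rw [← hk]; simp⟩
    choose k hk using h1
    refine ⟨k, ?_⟩
    ext i
    simp [← hk i]
  · rintro ⟨k, rfl⟩
    ext i
    simp [toTorus]

/-- If the solid part of the torus is connected, then all inner balls are linked. -/
theorem linked_ball_of_isConnected (hP : IsPeriodicSet P)
    (hconn : IsConnected (toTorus '' solid P)) {x z : Space n} {r s : ℝ}
    (hx : IsInnerBall P x r) (hz : IsInnerBall P z s) :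
    Linked P (volume.restrict (Metric.ball x r)) (volume.restrict (Metric.ball z s)) := by
  set ν := (volume : Measure (Space n)).restrict (Metric.ball z s)
  -- The points from which the target ball can be reached. Both `G` and its complement in the solid
  -- part are open, since the condition holds throughout an inner ball as soon as it holds at one
  -- point of it.
  set G : Set (Space n) := {y | y ∈ solid P ∧
    ∃ ρ > 0, Linked P (volume.restrict (Metric.ball y ρ)) ν} with hG
  have hstep : ∀ y ρ, IsInnerBall P y ρ → ∀ y' ∈ Metric.ball y ρ, y' ∈ G →
      Linked P (volume.restrict (Metric.ball y ρ)) ν := by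
    rintro y ρ hy y' hy' ⟨-, ρ', hρ', hlink⟩
    obtain ⟨τ, hτ, hsub⟩ := Metric.isOpen_iff.1 Metric.isOpen_ball y' hy'
    have h1 : Metric.ball y' (min τ ρ') ⊆ Metric.ball y ρ :=
      (Metric.ball_subset_ball (min_le_left _ _)).trans hsub
    refine ((hy.linked hP).mono le_rfl (Measure.restrict_mono_set _ h1)).trans
      (hlink.mono (Measure.restrict_mono_set _ (Metric.ball_subset_ball (min_le_right _ _)))
        le_rfl) (restrict_ball_ne_zero _ (lt_min hτ hρ'))
  have hback : ∀ y ρ, IsInnerBall P y ρ →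
      Linked P (volume.restrict (Metric.ball y ρ)) ν → ∀ y' ∈ Metric.ball y ρ, y' ∈ G := by
    intro y ρ hy hlink y' hy'
    obtain ⟨τ, hτ, hsub⟩ := Metric.isOpen_iff.1 Metric.isOpen_ball y' hy'
    refine ⟨hy.2.2 (Metric.ball_subset_ball (by linarith [hy.1]) hy'), τ, hτ,
      hlink.mono (Measure.restrict_mono_set _ hsub) le_rfl⟩
  have hGo : IsOpen G := by
    refine isOpen_iff_mem_nhds.2 fun y hy => ?_
    obtain ⟨ρ, hρ⟩ := exists_isInnerBall hy.1
    have := hstep y ρ hρ y (Metric.mem_ball_self hρ.1) hy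
    exact Filter.mem_of_superset (Metric.ball_mem_nhds _ hρ.1) (hback y ρ hρ this)
  have hGo' : IsOpen (solid P \ G) := by
    refine isOpen_iff_mem_nhds.2 fun y hy => ?_
    obtain ⟨ρ, hρ⟩ := exists_isInnerBall hy.1
    refine Filter.mem_of_superset (Metric.ball_mem_nhds _ hρ.1) fun y' hy' => ⟨hρ.2.2
      (Metric.ball_subset_ball (by linarith [hρ.1]) hy'), fun hG' => hy.2 ?_⟩
    exact hback y ρ hρ (hstep y ρ hρ y' hy' hG') y (Metric.mem_ball_self hρ.1)
  -- Only the image of the solid part in the torus is assumed connected; periodicity of `W` lets `G`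
  -- descend to the torus.
  have hGper : ∀ y ∈ G, ∀ k, y + intVec k ∈ G := by
    rintro y ⟨hy, ρ, hρ, C, hC, h⟩ k
    refine ⟨(hP.solid k y).2 hy, ρ, hρ, C, hC, fun W hW => ?_⟩
    refine le_of_eq_of_le ?_ (h W hW)
    have hpre : (fun x => x + intVec k) ⁻¹' Metric.ball (y + intVec k) ρ = Metric.ball y ρ := by
      ext x; simp
    rw [← (intInvariant_volume k).setLIntegral_comp_preimage_emb
      (measurableEmbedding_add_intVec k), hpre]
    simp_rw [hW.2 _ trivial k]
  have hzG : z ∈ G := ⟨hz.2.2 (Metric.mem_ball_self (by linarith [hz.1])), s, hz.1, hz.linked hP⟩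
  have hall : solid P ⊆ G := by
    by_contra hne
    obtain ⟨w, hw, hwG⟩ := not_subset.1 hne
    obtain ⟨_, -, ⟨y, hy, rfl⟩, ⟨y', hy', hyy'⟩⟩ := hconn.isPreconnected _ _
      (isOpenMap_toTorus _ hGo) (isOpenMap_toTorus _ hGo')
      (by rw [← image_union]; exact image_mono fun y hy => by
            by_cases h : y ∈ G
            · exact Or.inl h
            · exact Or.inr ⟨hy, h⟩)
      ⟨_, mem_image_of_mem _ hzG.1, mem_image_of_mem _ hzG⟩
      ⟨_, mem_image_of_mem _ hw, mem_image_of_mem _ ⟨hw, hwG⟩⟩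
    obtain ⟨k, rfl⟩ := toTorus_eq_iff.1 hyy'
    exact hy'.2 (hGper y hy k)
  exact hstep x r hx x (Metric.mem_ball_self hx.1)
    (hall (hx.2.2 (Metric.mem_ball_self (by linarith [hx.1]))))

end Linked

/-! ### Linking the boundary of the hole to an interior ball -/

section Boundary

variable {m : ℕ} {P : Set (Space (m + 1))}

/-- Points of a small boundary piece are pushed along the transversal direction into an inner ball.
The cost of the move is a gradient integral over the tube, and the oscillation at the end point is
that of the ball. -/
theorem exists_linked_boundary (hP : IsPeriodicSet P) (hPs : HasSmoothBoundary P)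
    {x₀ : Space (m + 1)} (hx₀ : x₀ ∈ frontier P) :
    ∃ δ > 0, ∃ x₁ ρ, IsInnerBall P x₁ ρ ∧
      surface (m + 1) (frontier P ∩ Metric.closedBall x₀ δ) < ⊤ ∧
      Linked P ((surface (m + 1)).restrict (frontier P ∩ Metric.closedBall x₀ δ))
        (volume.restrict (Metric.ball x₁ ρ)) := by
  obtain ⟨i, a, H, r, K, ha, hH, hr, htube, hK⟩ := hPs.exists_graph hx₀
  set e : Space (m + 1) := EuclideanSpace.single i a with he
  have hen : ‖e‖ = |a| := by rw [he, PiLp.norm_single, Real.norm_eq_abs]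
  have ha0 : 0 < |a| := abs_pos.2 ha
  set U := solid P ∩ Metric.ball x₀ (1 / 4) with hU
  have hUo : IsOpen U := (isOpen_solid P).inter Metric.isOpen_ball
  set x₁ := x₀ + (H / 2) • e with hx₁
  have hx₁U : x₁ ∈ U := htube x₀ ⟨hx₀, Metric.mem_closedBall_self hr.le⟩ (H / 2)
    ⟨by linarith, by linarith⟩
  obtain ⟨R, hR, hRU⟩ := Metric.isOpen_iff.1 hUo x₁ hx₁U
  set ρ := min R (1 / 4) / 3 with hρ
  have hρ0 : 0 < ρ := div_pos (lt_min hR (by norm_num)) three_pos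
  have hρ3 : 3 * ρ = min R (1 / 4) := by rw [hρ]; ring
  have hballU : Metric.ball x₁ (3 * ρ) ⊆ U :=
    (Metric.ball_subset_ball (hρ3.le.trans (min_le_left _ _))).trans hRU
  have hinner : IsInnerBall P x₁ ρ :=
    ⟨hρ0, hρ3.le.trans (min_le_right _ _), hballU.trans inter_subset_left⟩
  -- With `δ ≤ ρ / 4` and `η * |a| ≤ ρ / 4`, points of `S` moved by times in `J` land within `ρ / 2`
  -- of `x₁`.
  set δ := min r (ρ / 4)
  have hδ : 0 < δ := lt_min hr (by linarith)
  set η := min (H / 2) (ρ / (4 * |a|)) with hη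
  have hη0 : 0 < η := lt_min (by linarith) (by positivity)
  set S := frontier P ∩ Metric.closedBall x₀ δ with hS
  have hSr : S ⊆ frontier P ∩ Metric.closedBall x₀ r :=
    inter_subset_inter_right _ (Metric.closedBall_subset_closedBall (min_le_left _ _))
  have hSc : IsCompact S := (isCompact_closedBall x₀ δ).inter_left isClosed_frontier
  obtain ⟨C, hCfin, hC⟩ := exists_tube_le (H := H) hSc ha
    (fun y hy z hz => hK y (hSr hy) z (hSr hz))
  have hSfin : surface (m + 1) S < ⊤ := hCfin.trans_lt ENNReal.coe_lt_top
  refine ⟨δ, hδ, x₁, ρ, hinner, hSfin, ?_⟩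
  obtain ⟨C', hC', hB⟩ := hinner.linked hP
  set B := Metric.ball x₁ ρ with hBdef
  set J := Ioc (H / 2) (H / 2 + η) with hJ
  have hJH : J ⊆ Ioc 0 H := Ioc_subset_Ioc (by linarith)
    (by linarith [min_le_left (H / 2) (ρ / (4 * |a|))])
  have hJB : ∀ y ∈ S, ∀ t ∈ J, y + t • e ∈ B := by
    intro y hy t ht
    have h1 : y + t • e - x₁ = (y - x₀) + (t - H / 2) • e := by rw [hx₁]; module
    rw [hBdef, mem_ball_iff_norm, h1]
    have h2 : ‖y - x₀‖ ≤ ρ / 4 := by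
      rw [← dist_eq_norm]; exact (Metric.mem_closedBall.1 hy.2).trans (min_le_right _ _)
    have h3 : ‖(t - H / 2) • e‖ ≤ ρ / 4 := by
      rw [norm_smul, hen, Real.norm_eq_abs, abs_of_pos (by linarith [ht.1])]
      calc (t - H / 2) * |a| ≤ ρ / (4 * |a|) * |a| := by
            gcongr
            linarith [ht.2, min_le_right (H / 2) (ρ / (4 * |a|))]
        _ = ρ / 4 := by field_simp
    have := norm_add_le (y - x₀) ((t - H / 2) • e)
    linarith
  have hvJ : volume J = ENNReal.ofReal η := by rw [hJ, Real.volume_Ioc]; congr 1; ring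
  have hvJ0 : volume J ≠ 0 := by rw [hvJ]; simpa using hη0
  have hvJt : volume J ≠ ⊤ := by rw [hvJ]; exact ENNReal.ofReal_ne_top
  refine ⟨(volume J)⁻¹ * (volume B * volume J * ‖e‖ₑ * C + C * C'), ?_, fun W hW => ?_⟩
  · refine ENNReal.mul_ne_top (ENNReal.inv_ne_top.2 hvJ0) (ENNReal.add_ne_top.2 ⟨?_, ?_⟩)
    · exact ENNReal.mul_ne_top (ENNReal.mul_ne_top
        (ENNReal.mul_ne_top measure_ball_lt_top.ne hvJt) enorm_ne_top) ENNReal.coe_ne_top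
    · exact ENNReal.mul_ne_top ENNReal.coe_ne_top hC'
  have hm := measurable_enorm_sub hW.continuous
  have hm3 := hW.measurable_enorm_fderiv
  have htubeU : ∀ y ∈ S, ∀ t ∈ Ioc 0 H, y + t • e ∈ U := fun y hy => htube y (hSr hy)
  have hCU := fun F hF => hC U hUo.measurableSet htubeU F hF
  set Φ : Space (m + 1) → ℝ≥0∞ := fun x => ∫⁻ z in B, ‖W x - W z‖ₑ with hΦ
  have hΦm : Measurable Φ := hm.lintegral_prod_right
  set g : Space (m + 1) → ℝ≥0∞ := fun y => ∫⁻ t in Ioc 0 H, ‖fderiv ℝ W (y + t • e)‖ₑ with hg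
  have hgm : Measurable g := by
    refine Measurable.lintegral_prod_right' (f := fun p : Space (m + 1) × ℝ =>
      ‖fderiv ℝ W (p.1 + p.2 • e)‖ₑ) ?_
    exact hm3.comp (by fun_prop : Measurable fun p : Space (m + 1) × ℝ => p.1 + p.2 • e)
  -- Averaging over landing times in `J`, rather than fixing one, turns the surface integral of `Φ`
  -- at the end point into a volume integral over the ball, where the link of the ball applies.
  have hpt : ∀ y ∈ S, Φ y * volume J
      ≤ volume B * volume J * ‖e‖ₑ * g y
        + ∫⁻ t in Ioc 0 H, B.indicator Φ (y + t • e) := by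
    intro y hy
    have h1 : ∀ t ∈ J, Φ y ≤ volume B * (‖e‖ₑ * g y) + B.indicator Φ (y + t • e) := by
      intro t ht
      rw [indicator_of_mem (hJB y hy t ht)]
      have h2 : ‖W (y + t • e) - W y‖ₑ ≤ ‖e‖ₑ * g y := by
        have h := enorm_sub_le_lintegral_fderiv hW.1 y e (hJH ht).1.le
        rw [zero_smul, add_zero, lintegral_mul_const' _ _ enorm_ne_top, mul_comm] at h
        refine h.trans (mul_le_mul_right ?_ _)
        exact lintegral_mono_set (Ioc_subset_Ioc_right (hJH ht).2)
      calc Φ y ≤ ∫⁻ z in B, (‖e‖ₑ * g y + ‖W (y + t • e) - W z‖ₑ) := by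
            refine lintegral_mono fun z => ?_
            have : W y - W z = (W (y + t • e) - W z) - (W (y + t • e) - W y) := by ring
            rw [this, add_comm (‖e‖ₑ * g y)]
            exact enorm_sub_le.trans (add_le_add le_rfl h2)
        _ = _ := by
            rw [lintegral_add_left measurable_const, lintegral_const,
              Measure.restrict_apply_univ, mul_comm (volume B)]
    have hind : Measurable fun t : ℝ => B.indicator Φ (y + t • e) :=
      (hΦm.indicator measurableSet_ball).comp
        (by fun_prop : Measurable fun t : ℝ => y + t • e)
    calc Φ y * volume J = ∫⁻ _ in J, Φ y := by simp
      _ ≤ ∫⁻ t in J, (volume B * (‖e‖ₑ * g y) + B.indicator Φ (y + t • e)) :=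
          setLIntegral_mono' measurableSet_Ioc h1
      _ = volume B * (‖e‖ₑ * g y) * volume J + ∫⁻ t in J, B.indicator Φ (y + t • e) := by
          rw [lintegral_add_left measurable_const]; simp
      _ ≤ volume B * (‖e‖ₑ * g y) * volume J
            + ∫⁻ t in Ioc 0 H, B.indicator Φ (y + t • e) := by
          gcongr
      _ = _ := by congr 1; ring
  have key : volume J * ∫⁻ y in S, Φ y ∂(surface (m + 1))
      ≤ (volume B * volume J * ‖e‖ₑ * C + C * C') * cellGrad P W := by
    calc volume J * ∫⁻ y in S, Φ y ∂(surface (m + 1))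
        = ∫⁻ y in S, Φ y * volume J ∂(surface (m + 1)) := by
          rw [lintegral_mul_const' _ _ hvJt, mul_comm]
      _ ≤ ∫⁻ y in S, (volume B * volume J * ‖e‖ₑ * g y
            + ∫⁻ t in Ioc 0 H, B.indicator Φ (y + t • e)) ∂(surface (m + 1)) :=
          setLIntegral_mono' hSc.measurableSet hpt
      _ = volume B * volume J * ‖e‖ₑ * (∫⁻ y in S, g y ∂(surface (m + 1)))
            + ∫⁻ y in S, (∫⁻ t in Ioc 0 H, B.indicator Φ (y + t • e)) ∂(surface (m + 1)) := by
          rw [lintegral_add_left (hgm.const_mul _), lintegral_const_mul _ hgm]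
      _ ≤ volume B * volume J * ‖e‖ₑ * (C * cellGrad P W) + C * (C' * cellGrad P W) := by
          gcongr
          · refine (hCU _ hm3).trans (mul_le_mul_right ?_ _)
            exact setLIntegral_fderiv_le_cellGrad hP hUo.measurableSet subset_rfl hW
          · refine (hCU _ (hΦm.indicator measurableSet_ball)).trans (mul_le_mul_right ?_ _)
            refine le_trans ?_ (hB W hW)
            rw [← lintegral_indicator measurableSet_ball]
            exact setLIntegral_le_lintegral _ _
      _ = _ := by ring
  rw [mul_assoc, mul_comm, ← div_eq_mul_inv, ENNReal.le_div_iff_mul_le (Or.inl hvJ0)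
    (Or.inl hvJt), mul_comm]
  exact key

theorem unitCell_subset_closedBall :
    unitCell (m + 1) ⊆ Metric.closedBall (0 : Space (m + 1)) (1 + m * 1) := by
  intro y hy
  rw [mem_closedBall_zero_iff]
  have hy' : ∀ i, |y i| ≤ 1 := fun i => by
    rw [abs_of_nonneg (hy i).1]; exact (hy i).2.le
  refine (norm_le_abs_add_dropCoord 0 y).trans ?_
  gcongr
  · exact hy' 0
  · exact (pi_norm_le_iff_of_nonneg zero_le_one).2 fun j => hy' _

theorem exists_linked_holeSurface (hP : IsPeriodicSet P) (hPs : HasSmoothBoundary P)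
    (hconn : IsConnected (toTorus '' solid P)) :
    ∃ z r, IsInnerBall P z r ∧ IsFiniteMeasure (holeSurface P) ∧
      Linked P (holeSurface P) (volume.restrict (Metric.ball z r)) := by
  obtain ⟨_, z, hz, -⟩ := hconn.nonempty
  obtain ⟨r, hr⟩ := exists_isInnerBall hz
  refine ⟨z, r, hr, ?_⟩
  set σ := surface (m + 1)
  set ν := (volume : Measure (Space (m + 1))).restrict (Metric.ball z r)
  have hmono : ∀ s t, s ⊆ t → σ (frontier P ∩ t) < ⊤ ∧ Linked P (σ.restrict (frontier P ∩ t)) ν →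
      σ (frontier P ∩ s) < ⊤ ∧ Linked P (σ.restrict (frontier P ∩ s)) ν := by
    intro s t hst h
    have h1 := inter_subset_inter_right (frontier P) hst
    exact ⟨(measure_mono h1).trans_lt h.1, h.2.mono (Measure.restrict_mono_set _ h1) le_rfl⟩
  have h0 : σ (frontier P ∩ ∅) < ⊤ ∧ Linked P (σ.restrict (frontier P ∩ ∅)) ν := by
    rw [inter_empty, Measure.restrict_empty]
    exact ⟨by simp, 0, by simp, by simp⟩
  -- The property is local and stable under finite unions, so it passes to a compact set containing
  -- the unit cell.
  have h := (isCompact_closedBall (0 : Space (m + 1)) (1 + m * 1)).induction_on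
    (p := fun s => σ (frontier P ∩ s) < ⊤ ∧ Linked P (σ.restrict (frontier P ∩ s)) ν)
    h0 (fun s t => hmono s t)
    (fun s t hs ht => by
      rw [inter_union_distrib_left]
      exact ⟨(measure_union_le _ _).trans_lt (ENNReal.add_lt_top.2 ⟨hs.1, ht.1⟩),
        (hs.2.add ht.2).mono (Measure.restrict_union_le _ _) le_rfl⟩)
    (fun x _ => by
      by_cases hx : x ∈ frontier P
      · obtain ⟨δ, hδ, x₁, ρ, hin, hfin, hlink⟩ := exists_linked_boundary hP hPs hx
        have : IsFiniteMeasure (σ.restrict (frontier P ∩ Metric.closedBall x δ)) :=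
          ⟨by rwa [Measure.restrict_apply_univ]⟩
        exact ⟨_, mem_nhdsWithin_of_mem_nhds (Metric.closedBall_mem_nhds x hδ), hfin,
          hlink.trans (linked_ball_of_isConnected hP hconn hin hr)
            (restrict_ball_ne_zero _ hin.1)⟩
      · refine ⟨(frontier P)ᶜ,
          mem_nhdsWithin_of_mem_nhds (isClosed_frontier.isOpen_compl.mem_nhds hx), ?_⟩
        rw [inter_compl_self]
        simpa using h0)
  have h' := hmono _ _ unitCell_subset_closedBall h
  exact ⟨⟨by rw [holeSurface, Measure.restrict_apply_univ]; exact h'.1⟩, h'.2⟩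

/-- Trace and Poincaré inequalities for periodic functions on a period of the solid part. -/
theorem exists_cell_bound (hP : IsPeriodicSet P) (hPs : HasSmoothBoundary P)
    (hconn : IsConnected (toTorus '' solid P)) :
    IsFiniteMeasure (holeSurface P) ∧ ∃ C : ℝ≥0∞, C ≠ ⊤ ∧ ∀ W, IsPeriodicC1 W →
      ∫⁻ y, ‖W y‖ₑ ∂(holeSurface P)
        ≤ C * ((∫⁻ x in solid P ∩ unitCell (m + 1), ‖W x‖ₑ) + cellGrad P W) ∧
      ∃ c : ℝ, ∫⁻ y, ‖W y - c‖ₑ ∂(holeSurface P) ≤ C * cellGrad P W := by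
  obtain ⟨z, r, hin, hfin, hlink⟩ := exists_linked_holeSurface hP hPs hconn
  refine ⟨hfin, ?_⟩
  obtain ⟨C, hC, h⟩ := hlink
  obtain ⟨C', hC', h'⟩ := Linked.symm ⟨C, hC, h⟩
  set B := Metric.ball z r
  have hB0 : volume B ≠ 0 := (Metric.measure_ball_pos _ _ hin.1).ne'
  have hBt : volume B ≠ ⊤ := measure_ball_lt_top.ne
  have hBs : B ⊆ solid P ∩ Metric.ball z (1 / 4) :=
    (Metric.ball_subset_ball (by linarith [hin.1])).trans hin.subset
  refine ⟨max ((volume B)⁻¹ * (C + holeSurface P univ)) ((volume B)⁻¹ * C'), ?_,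
    fun W hW => ⟨?_, ?_⟩⟩
  · refine (max_lt ?_ ?_).ne
    · exact ENNReal.mul_lt_top (ENNReal.inv_lt_top.2 (pos_iff_ne_zero.2 hB0))
        (ENNReal.add_lt_top.2 ⟨hC.lt_top, measure_lt_top _ _⟩)
    · exact ENNReal.mul_lt_top (ENNReal.inv_lt_top.2 (pos_iff_ne_zero.2 hB0)) hC'.lt_top
  · have hm := measurable_enorm_sub hW.continuous
    refine le_trans ?_ (mul_le_mul_left (le_max_left _ _) _)
    rw [mul_assoc, mul_comm, ← div_eq_mul_inv, ENNReal.le_div_iff_mul_le (Or.inl hB0)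
      (Or.inl hBt)]
    calc (∫⁻ y, ‖W y‖ₑ ∂(holeSurface P)) * volume B
        = ∫⁻ y, (∫⁻ _ in B, ‖W y‖ₑ) ∂(holeSurface P) := by
          rw [← lintegral_mul_const' _ _ hBt]; simp
      _ ≤ ∫⁻ y, (∫⁻ x in B, (‖W y - W x‖ₑ + ‖W x‖ₑ)) ∂(holeSurface P) := by
          refine lintegral_mono fun y => lintegral_mono fun x => ?_
          simpa using enorm_add_le (W y - W x) (W x)
      _ = ∫⁻ y, ((∫⁻ x in B, ‖W y - W x‖ₑ) + ∫⁻ x in B, ‖W x‖ₑ) ∂(holeSurface P) := by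
          refine lintegral_congr fun y => lintegral_add_left (hm.comp measurable_prodMk_left) _
      _ = (∫⁻ y, (∫⁻ x in B, ‖W y - W x‖ₑ) ∂(holeSurface P))
            + (∫⁻ x in B, ‖W x‖ₑ) * holeSurface P univ := by
          rw [lintegral_add_right _ measurable_const, lintegral_const]
      _ ≤ C * cellGrad P W + (∫⁻ x in solid P ∩ unitCell (m + 1), ‖W x‖ₑ)
            * holeSurface P univ := by
          refine add_le_add (h W hW) (mul_le_mul_left ?_ _)
          exact setLIntegral_le_cell hP measurableSet_ball hBs hW.continuous.enorm.measurable
            fun y hy k => congrArg enorm (hW.2 y hy k)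
      _ ≤ (C + holeSurface P univ) *
            ((∫⁻ x in solid P ∩ unitCell (m + 1), ‖W x‖ₑ) + cellGrad P W) := by
          rw [add_mul, mul_comm _ (holeSurface P univ)]
          gcongr
          · exact le_add_self
          · exact le_self_add
  · have hm : Measurable fun x => ∫⁻ y, ‖W x - W y‖ₑ ∂(holeSurface P) :=
      (measurable_enorm_sub hW.continuous).lintegral_prod_right
    -- Some point of the ball does no worse than the average; the value of `W` there serves as `c`.
    obtain ⟨x, -, hx⟩ := exists_le_setLAverage hB0 hBt hm.aemeasurable.restrict
    refine ⟨W x, ?_⟩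
    simp_rw [enorm_sub_rev _ (W x)]
    refine hx.trans ?_
    rw [setLAverage_eq, ENNReal.div_eq_inv_mul]
    refine le_trans ?_ (mul_le_mul_left (le_max_right _ _) _)
    rw [mul_assoc]
    exact mul_le_mul_right (h' W hW) _

end Boundary

/-! ### Periodization of compactly supported functions -/

section Periodize

variable {n : ℕ}

/-- The sum of the integer translates of `w`. -/
noncomputable def periodize (w : Space n → ℝ) : Space n → ℝ := fun x => ∑' k, w (x + intVec k)

theorem exists_finset_translate {w : Space n → ℝ} (hw : HasCompactSupport w) (R : ℝ) :
    ∃ s : Finset (Fin n → ℤ), ∀ x ∈ Metric.ball (0 : Space n) R, ∀ k ∉ s, w (x + intVec k) = 0 := by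
  obtain ⟨R', hR'⟩ := hw.isCompact.isBounded.subset_closedBall (0 : Space n)
  refine ⟨Finset.Icc (fun _ => -⌈R + R'⌉) (fun _ => ⌈R + R'⌉), fun x hx k hk => ?_⟩
  by_contra h
  refine hk ?_
  have h1 := hR' (subset_tsupport w h)
  rw [mem_closedBall_zero_iff] at h1
  rw [mem_ball_zero_iff] at hx
  have h2 : ‖intVec k‖ ≤ R + R' := by
    have := norm_sub_le (x + intVec k) x
    rw [add_sub_cancel_left] at this
    linarith
  have h3 : ∀ i, |(k i : ℝ)| ≤ ⌈R + R'⌉ := fun i => by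
    have := PiLp.norm_apply_le (intVec k) i
    rw [intVec_apply, Real.norm_eq_abs] at this
    exact (this.trans h2).trans (Int.le_ceil _)
  rw [Finset.mem_Icc]
  constructor <;> intro i <;> have := abs_le.1 (h3 i)
  · exact_mod_cast this.1
  · exact_mod_cast this.2

theorem exists_periodize_eq_sum {w : Space n → ℝ} (hw : HasCompactSupport w) (x : Space n) :
    ∃ s : Finset (Fin n → ℤ), ∀ᶠ y in 𝓝 x, periodize w y = ∑ k ∈ s, w (y + intVec k) := by
  obtain ⟨s, hs⟩ := exists_finset_translate hw (‖x‖ + 1)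
  refine ⟨s, ?_⟩
  have : Metric.ball (0 : Space n) (‖x‖ + 1) ∈ 𝓝 x :=
    Metric.isOpen_ball.mem_nhds (by rw [mem_ball_zero_iff]; linarith)
  filter_upwards [this] with y hy
  exact tsum_eq_sum fun k hk => hs y hy k hk

theorem isPeriodicC1_periodize {w : Space n → ℝ} (hw : HasCompactSupport w)
    (hw1 : ContDiff ℝ 1 w) : IsPeriodicC1 (periodize w) := by
  constructor
  · refine contDiff_iff_contDiffAt.2 fun x => ?_
    obtain ⟨s, hs⟩ := exists_periodize_eq_sum hw x
    refine ContDiffAt.congr_of_eventuallyEq (ContDiff.contDiffAt ?_) hs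
    exact ContDiff.sum fun k _ => hw1.comp (contDiff_id.add contDiff_const)
  · intro y _ k
    unfold periodize
    simp_rw [add_assoc, ← intVec_add]
    exact (Equiv.addLeft k).tsum_eq fun l => w (y + intVec l)

theorem enorm_periodize_le {w : Space n → ℝ} (hw : HasCompactSupport w) (x : Space n) :
    ‖periodize w x‖ₑ ≤ ∑' k, ‖w (x + intVec k)‖ₑ := by
  obtain ⟨s, hs⟩ := exists_periodize_eq_sum hw x
  rw [hs.self_of_nhds]
  exact (enorm_sum_le s _).trans (ENNReal.sum_le_tsum s)

/-- Positivity excludes cancellation between translates, so the boundary integral of `w` is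
recovered exactly and can be bounded from above by that of its periodization. -/
theorem enorm_periodize_eq {w : Space n → ℝ} (hw : HasCompactSupport w) (hw0 : ∀ x, 0 ≤ w x)
    (x : Space n) : ‖periodize w x‖ₑ = ∑' k, ‖w (x + intVec k)‖ₑ := by
  obtain ⟨s, hs⟩ := exists_finset_translate hw (‖x‖ + 1)
  have hx : x ∈ Metric.ball (0 : Space n) (‖x‖ + 1) := by
    rw [mem_ball_zero_iff]; linarith
  have hsum : Summable fun k => w (x + intVec k) :=
    summable_of_ne_finset_zero (s := s) fun k hk => hs x hx k hk
  unfold periodize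
  rw [Real.enorm_of_nonneg (tsum_nonneg fun k => hw0 _),
    ENNReal.ofReal_tsum_of_nonneg (fun k => hw0 _) hsum]
  simp_rw [Real.enorm_of_nonneg (hw0 _)]

theorem enorm_fderiv_periodize_le {w : Space n → ℝ} (hw : HasCompactSupport w)
    (hw1 : ContDiff ℝ 1 w) (x : Space n) :
    ‖fderiv ℝ (periodize w) x‖ₑ ≤ ∑' k, ‖fderiv ℝ w (x + intVec k)‖ₑ := by
  obtain ⟨s, hs⟩ := exists_periodize_eq_sum hw x
  have h1 : fderiv ℝ (periodize w) x = ∑ k ∈ s, fderiv ℝ w (x + intVec k) := by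
    rw [Filter.EventuallyEq.fderiv_eq hs, fderiv_fun_sum]
    · simp_rw [fderiv_comp_add_right]
    · intro k _
      exact ((hw1.differentiable (by simp)).comp (differentiable_id.add_const _)) x
  rw [h1]
  refine le_trans ?_ (ENNReal.sum_le_tsum s)
  exact enorm_sum_le (ε := Space n →L[ℝ] ℝ) s _

variable {P : Set (Space n)}

theorem IntInvariant.lintegral_tsum_eq {ν : Measure (Space n)} (hν : IntInvariant ν)
    {Q : Set (Space n)} (hQ : IsPeriodicSet Q) (hQm : MeasurableSet Q) {F : Space n → ℝ≥0∞}
    (hF : Measurable F) :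
    ∫⁻ y in Q ∩ unitCell n, ∑' k, F (y + intVec k) ∂ν = ∫⁻ y in Q, F y ∂ν := by
  rw [hν.setLIntegral_eq_tsum hQ hQm]
  exact lintegral_tsum fun k =>
    (hF.comp (measurableEmbedding_add_intVec k).measurable).aemeasurable

theorem lintegral_holeSurface_periodize (hP : IsPeriodicSet P) {w : Space n → ℝ}
    (hw : HasCompactSupport w) (hw1 : Continuous w) (hw0 : ∀ x, 0 ≤ w x) :
    ∫⁻ y, ‖periodize w y‖ₑ ∂(holeSurface P) = ∫⁻ y in frontier P, ‖w y‖ₑ ∂(surface n) := by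
  rw [← intInvariant_surface.lintegral_tsum_eq hP.frontier isClosed_frontier.measurableSet
    hw1.enorm.measurable]
  exact lintegral_congr fun y => enorm_periodize_eq hw hw0 y

theorem cellGrad_periodize_le (hP : IsPeriodicSet P) {w : Space n → ℝ}
    (hw : HasCompactSupport w) (hw1 : ContDiff ℝ 1 w) :
    cellGrad P (periodize w) ≤ ∫⁻ x in solid P, ‖fderiv ℝ w x‖ₑ := by
  rw [← intInvariant_volume.lintegral_tsum_eq hP.solid (isOpen_solid P).measurableSet
    (hw1.continuous_fderiv (by simp)).enorm.measurable]
  exact lintegral_mono fun x => enorm_fderiv_periodize_le hw hw1 x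

theorem lintegral_solid_periodize_le (hP : IsPeriodicSet P) {w : Space n → ℝ}
    (hw : HasCompactSupport w) (hw1 : Continuous w) :
    ∫⁻ x in solid P ∩ unitCell n, ‖periodize w x‖ₑ ≤ ∫⁻ x in solid P, ‖w x‖ₑ := by
  rw [← intInvariant_volume.lintegral_tsum_eq hP.solid (isOpen_solid P).measurableSet
    hw1.enorm.measurable]
  exact lintegral_mono fun x => enorm_periodize_le hw x

theorem ae_enorm_le_eLpNorm_top (hP : IsPeriodicSet P) {α : Space n → ℝ}
    (hα : IsPeriodicOn α (frontier P)) :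
    ∀ᵐ y ∂(surface n).restrict (frontier P), ‖α y‖ₑ ≤ eLpNorm α ⊤ (holeSurface P) := by
  refine intInvariant_surface.ae_restrict hP.frontier isClosed_frontier.measurableSet
    (fun y hy k h => by rwa [hα y hy k]) ?_
  rw [eLpNorm_exponent_top]
  exact ae_le_eLpNormEssSup

/-- Periodicity moves the translation from `α w` to `w` alone; `hfin` and the `L^∞` bound on `α`
give the absolute convergence needed to exchange sum and integral. -/
theorem integral_periodize_eq (hP : IsPeriodicSet P) {α w : Space n → ℝ}
    (hα : IsPeriodicOn α (frontier P)) (hαm : MemLp α ⊤ (holeSurface P))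
    (hw1 : Continuous w)
    (hfin : ∫⁻ y in frontier P, ‖w y‖ₑ ∂(surface n) ≠ ⊤) :
    ∫ y, α y * periodize w y ∂(holeSurface P)
      = ∫ y in frontier P, α y * w y ∂(surface n) := by
  have hQ := hP.frontier
  have hQm : MeasurableSet (frontier P) := isClosed_frontier.measurableSet
  have hαQ := intInvariant_surface.aestronglyMeasurable hQ hQm hα hαm.1
  have hlt : ∫⁻ y in frontier P, ‖α y * w y‖ₑ ∂(surface n) ≠ ⊤ := by
    refine ne_top_of_le_ne_top (ENNReal.mul_ne_top hαm.2.ne hfin) ?_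
    rw [← lintegral_const_mul' _ _ hαm.2.ne]
    refine lintegral_mono_ae ?_
    filter_upwards [ae_enorm_le_eLpNorm_top hP hα] with y hy
    rw [enorm_mul]
    gcongr
  have hint : IntegrableOn (fun y => α y * w y) (frontier P) (surface n) :=
    ⟨hαQ.mul hw1.aestronglyMeasurable, hlt.lt_top⟩
  have hsum := intInvariant_surface.hasSum_setIntegral hQ hQm hint
  have hcongr : ∀ k, ∀ᵐ y ∂(surface n).restrict (frontier P ∩ unitCell n),
      α (y + intVec k) * w (y + intVec k) = α y * w (y + intVec k) := fun k => by
    filter_upwards [ae_restrict_mem (hQm.inter measurableSet_unitCell)] with y hy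
    rw [hα y hy.1 k]
  have hwk : ∀ k, Continuous fun y => w (y + intVec k) := fun k => by fun_prop
  simp_rw [integral_congr_ae (hcongr _)] at hsum
  rw [← hsum.tsum_eq, holeSurface]
  simp_rw [periodize, ← tsum_mul_left]
  refine integral_tsum (fun k => hαm.1.mul (hwk k).aestronglyMeasurable) ?_
  rw [intInvariant_surface.setLIntegral_eq_tsum hQ hQm] at hlt
  refine ne_of_eq_of_ne (tsum_congr fun k => lintegral_congr_ae ?_) hlt
  filter_upwards [hcongr k] with y hy
  rw [hy]

end Periodize

/-! ### Estimates on the whole periodic structure at scale one -/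

section Unfolded

variable {m : ℕ} {P : Set (Space (m + 1))}

/-- The trace inequality and the cancellation effect of a weight of mean zero, for non-negative
functions of compact support. -/
theorem exists_unfolded_bound (hP : IsPeriodicSet P) (hPs : HasSmoothBoundary P)
    (hconn : IsConnected (toTorus '' solid P)) :
    ∃ C : ℝ≥0∞, C ≠ ⊤ ∧ ∀ w : Space (m + 1) → ℝ, HasCompactSupport w → ContDiff ℝ 1 w →
      (∀ x, 0 ≤ w x) →
      ∫⁻ y in frontier P, ‖w y‖ₑ ∂(surface (m + 1))
        ≤ C * ((∫⁻ x in solid P, ‖w x‖ₑ) + ∫⁻ x in solid P, ‖fderiv ℝ w x‖ₑ) ∧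
      ∀ α : Space (m + 1) → ℝ, IsPeriodicOn α (frontier P) → MemLp α ⊤ (holeSurface P) →
        ∫ y, α y ∂(holeSurface P) = 0 →
        ‖∫ y in frontier P, α y * w y ∂(surface (m + 1))‖ₑ
          ≤ C * (eLpNorm α ⊤ (holeSurface P) * ∫⁻ x in solid P, ‖fderiv ℝ w x‖ₑ) := by
  obtain ⟨hfinm, C, hC, h⟩ := exists_cell_bound hP hPs hconn
  refine ⟨C, hC, fun w hw hw1 hw0 => ?_⟩
  have hW := isPeriodicC1_periodize hw hw1
  obtain ⟨h1, c, h2⟩ := h _ hW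
  have h3 : ∫⁻ y in frontier P, ‖w y‖ₑ ∂(surface (m + 1))
        ≤ C * ((∫⁻ x in solid P, ‖w x‖ₑ) + ∫⁻ x in solid P, ‖fderiv ℝ w x‖ₑ) := by
    rw [← lintegral_holeSurface_periodize hP hw hw1.continuous hw0]
    refine h1.trans (mul_le_mul_right (add_le_add ?_ ?_) _)
    · exact lintegral_solid_periodize_le hP hw hw1.continuous
    · exact cellGrad_periodize_le hP hw hw1
  refine ⟨h3, fun α hα hαm hα0 => ?_⟩
  have hf1 : ∫⁻ x in solid P, ‖w x‖ₑ ≠ ⊤ :=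
    (hw1.continuous.integrable_of_hasCompactSupport hw).integrableOn.2.ne
  have hf2 : ∫⁻ x in solid P, ‖fderiv ℝ w x‖ₑ ≠ ⊤ :=
    ((hw1.continuous_fderiv (by simp)).integrable_of_hasCompactSupport
      (hw.fderiv ℝ)).integrableOn.2.ne
  -- Finiteness on the boundary is read off from the trace inequality just proved.
  have hfin : ∫⁻ y in frontier P, ‖w y‖ₑ ∂(surface (m + 1)) ≠ ⊤ :=
    ne_top_of_le_ne_top (ENNReal.mul_ne_top hC (ENNReal.add_ne_top.2 ⟨hf1, hf2⟩)) h3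
  have hWint : Integrable (periodize w) (holeSurface P) := by
    refine ⟨hW.continuous.aestronglyMeasurable, ?_⟩
    rw [HasFiniteIntegral, lintegral_holeSurface_periodize hP hw hw1.continuous hw0]
    exact hfin.lt_top
  have hαint : Integrable α (holeSurface P) := hαm.integrable le_top
  have hαW : Integrable (fun y => α y * periodize w y) (holeSurface P) :=
    hαm.integrable_mul (memLp_one_iff_integrable.2 hWint)
  -- The cancellation: `α` has mean zero, so only the oscillation of the periodized function counts.
  have hsub : ∫ y, α y * (periodize w y - c) ∂(holeSurface P)
      = ∫ y, α y * periodize w y ∂(holeSurface P) := by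
    simp_rw [mul_sub]
    rw [integral_sub hαW (hαint.mul_const c), integral_mul_const, hα0, zero_mul, sub_zero]
  rw [← integral_periodize_eq hP hα hαm hw1.continuous hfin, ← hsub]
  calc ‖∫ y, α y * (periodize w y - c) ∂(holeSurface P)‖ₑ
      ≤ ∫⁻ y, ‖α y * (periodize w y - c)‖ₑ ∂(holeSurface P) :=
        enorm_integral_le_lintegral_enorm _
    _ ≤ ∫⁻ y, eLpNorm α ⊤ (holeSurface P) * ‖periodize w y - c‖ₑ ∂(holeSurface P) := by
        refine lintegral_mono_ae ?_
        rw [eLpNorm_exponent_top]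
        filter_upwards [ae_le_eLpNormEssSup (f := α) (μ := holeSurface P)] with y hy
        rw [enorm_mul]
        gcongr
    _ = eLpNorm α ⊤ (holeSurface P) * ∫⁻ y, ‖periodize w y - c‖ₑ ∂(holeSurface P) :=
        lintegral_const_mul' _ _ hαm.2.ne
    _ ≤ eLpNorm α ⊤ (holeSurface P) * (C * ∫⁻ x in solid P, ‖fderiv ℝ w x‖ₑ) := by
        refine mul_le_mul_right (h2.trans (mul_le_mul_right ?_ _)) _
        exact cellGrad_periodize_le hP hw hw1
    _ = _ := by ring

end Unfolded

/-! ### Dilations of volume and surface measure -/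

section Scaling

variable {n : ℕ}

/-- A measure that scales with the power `d` under dilations. -/
def IsHomogeneous (ν : Measure (Space n)) (d : ℕ) : Prop :=
  ∀ r : ℝ, 0 < r → Measure.map (fun y => r • y) ν = ENNReal.ofReal ((r ^ d)⁻¹) • ν

theorem measurableEmbedding_smul {r : ℝ} (hr : 0 < r) :
    MeasurableEmbedding (fun y : Space n => r • y) :=
  (Homeomorph.smulOfNeZero r hr.ne').measurableEmbedding

theorem isHomogeneous_volume : IsHomogeneous (volume : Measure (Space n)) n := by
  intro r hr
  have := Measure.map_addHaar_smul (volume : Measure (Space n)) hr.ne'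
  rwa [finrank_euclideanSpace_fin, abs_of_pos (by positivity)] at this

theorem isHomogeneous_surface : IsHomogeneous (surface n) (n - 1) := by
  intro r hr
  ext s hs
  rw [Measure.map_apply (measurableEmbedding_smul hr).measurable hs, preimage_smul₀ hr.ne',
    surface, Measure.euclideanHausdorffMeasure_smul₀ _ (inv_ne_zero hr.ne'), Measure.smul_apply,
    smul_eq_mul, ENNReal.smul_def, smul_eq_mul]
  congr 1
  rw [← inv_pow, ENNReal.coe_pow, ENNReal.ofReal_pow (by positivity)]
  congr 1
  rw [← Real.enorm_of_nonneg (by positivity), enorm_eq_nnnorm]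

/-- The dilation of the set `Q`. -/
def dilate (r : ℝ) (Q : Set (Space n)) : Set (Space n) := (fun x => r⁻¹ • x) ⁻¹' Q

theorem preimage_dilate {r : ℝ} (hr : 0 < r) (Q : Set (Space n)) :
    (fun y => r • y) ⁻¹' dilate r Q = Q := by
  ext y; simp [dilate, smul_smul, hr.ne']

theorem measurableSet_dilate {r : ℝ} {Q : Set (Space n)} (hQ : MeasurableSet Q) :
    MeasurableSet (dilate r Q) := hQ.preimage (by fun_prop)

variable {ν : Measure (Space n)} {d : ℕ}

theorem IsHomogeneous.setLIntegral (hν : IsHomogeneous ν d) {r : ℝ} (hr : 0 < r)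
    (Q : Set (Space n)) (f : Space n → ℝ≥0∞) :
    ∫⁻ y in Q, f (r • y) ∂ν = ENNReal.ofReal ((r ^ d)⁻¹) * ∫⁻ x in dilate r Q, f x ∂ν := by
  have he := measurableEmbedding_smul (n := n) hr
  rw [← smul_eq_mul, ← lintegral_smul_measure, ← Measure.restrict_smul, ← hν r hr, he.restrict_map,
    he.lintegral_map, preimage_dilate hr]

theorem IsHomogeneous.setIntegral (hν : IsHomogeneous ν d) {r : ℝ} (hr : 0 < r)
    (Q : Set (Space n)) (f : Space n → ℝ) :
    ∫ y in Q, f (r • y) ∂ν = (r ^ d)⁻¹ * ∫ x in dilate r Q, f x ∂ν := by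
  have he := measurableEmbedding_smul (n := n) hr
  have h : ∫ x in dilate r Q, f x ∂(ENNReal.ofReal ((r ^ d)⁻¹) • ν)
      = (r ^ d)⁻¹ * ∫ x in dilate r Q, f x ∂ν := by
    rw [Measure.restrict_smul, integral_smul_measure, ENNReal.toReal_ofReal (by positivity),
      smul_eq_mul]
  rw [← h, ← hν r hr, he.setIntegral_map, preimage_dilate hr]

theorem IsHomogeneous.quasiMeasurePreserving (hν : IsHomogeneous ν d) {r : ℝ} (hr : 0 < r)
    (Q : Set (Space n)) :
    Measure.QuasiMeasurePreserving (fun x => r⁻¹ • x) (ν.restrict (dilate r Q))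
      (ν.restrict Q) := by
  have he := measurableEmbedding_smul (n := n) (inv_pos.2 hr)
  refine ⟨he.measurable, ?_⟩
  rw [dilate, ← he.restrict_map, hν _ (inv_pos.2 hr), Measure.restrict_smul]
  exact Measure.smul_absolutelyContinuous

end Scaling

/-! ### Rescaling the estimates to size `ε` -/

section Test

variable {m : ℕ} {P : Set (Space (m + 1))}

theorem fderiv_sq_comp_smul {φ : Space (m + 1) → ℝ} (hφ : ContDiff ℝ 1 φ) (r : ℝ)
    (y : Space (m + 1)) :
    ‖fderiv ℝ (fun y => φ (r • y) ^ 2) y‖ₑ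
      = ‖r‖ₑ * (2 * (‖φ (r • y)‖ₑ * ‖fderiv ℝ φ (r • y)‖ₑ)) := by
  have h1 : HasFDerivAt φ (fderiv ℝ φ (r • y)) (r • y) :=
    (hφ.differentiable (by simp) _).hasFDerivAt
  have h2 : HasFDerivAt (fun y : Space (m + 1) => r • y)
      (r • ContinuousLinearMap.id ℝ (Space (m + 1))) y :=
    (hasFDerivAt_id y).const_smul r
  have h3 := (h1.comp y h2).pow 2
  have h4 : fderiv ℝ (fun y => φ (r • y) ^ 2) y
      = (r * (2 * φ (r • y))) • fderiv ℝ φ (r • y) := by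
    refine h3.fderiv.trans ?_
    ext v
    simp
    ring
  rw [h4, enorm_smul, enorm_mul, enorm_mul]
  have : ‖(2 : ℝ)‖ₑ = 2 := by rw [Real.enorm_of_nonneg zero_le_two]; simp
  rw [this]
  ring

theorem exists_scaled_bound (hP : IsPeriodicSet P) (hPs : HasSmoothBoundary P)
    (hconn : IsConnected (toTorus '' solid P)) :
    ∃ C : ℝ≥0∞, C ≠ ⊤ ∧ ∀ φ : Space (m + 1) → ℝ, HasCompactSupport φ → ContDiff ℝ 1 φ →
      ∀ r : ℝ, 0 < r →
      ∫⁻ x in dilate r (frontier P), ‖φ x‖ₑ ^ 2 ∂(surface (m + 1))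
        ≤ C * (ENNReal.ofReal r⁻¹ * (∫⁻ x in dilate r (solid P), ‖φ x‖ₑ ^ 2)
          + ∫⁻ x in dilate r (solid P), 2 * (‖φ x‖ₑ * ‖fderiv ℝ φ x‖ₑ)) ∧
      ∀ α : Space (m + 1) → ℝ, IsPeriodicOn α (frontier P) → MemLp α ⊤ (holeSurface P) →
        ∫ y, α y ∂(holeSurface P) = 0 →
        ‖∫ x in dilate r (frontier P), α (r⁻¹ • x) * φ x ^ 2 ∂(surface (m + 1))‖ₑ
          ≤ C * (eLpNorm α ⊤ (holeSurface P)
            * ∫⁻ x in dilate r (solid P), 2 * (‖φ x‖ₑ * ‖fderiv ℝ φ x‖ₑ)) := by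
  obtain ⟨C, hC, h⟩ := exists_unfolded_bound hP hPs hconn
  refine ⟨C, hC, fun φ hφ hφ1 r hr => ?_⟩
  set w : Space (m + 1) → ℝ := fun y => φ (r • y) ^ 2 with hw
  have hwc : HasCompactSupport w := by
    have h1 : HasCompactSupport fun y => φ (r • y) :=
      hφ.comp_homeomorph (Homeomorph.smulOfNeZero r hr.ne')
    exact h1.comp_left (g := fun t : ℝ => t ^ 2) (by simp)
  have hw1 : ContDiff ℝ 1 w := (hφ1.comp (contDiff_const_smul r)).pow 2
  obtain ⟨h1, h2⟩ := h w hwc hw1 fun x => sq_nonneg _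
  set c := ENNReal.ofReal ((r ^ m)⁻¹) with hc
  have hc0 : c ≠ 0 := by rw [hc]; simpa using pow_pos hr m
  have hct : c ≠ ⊤ := ENNReal.ofReal_ne_top
  -- Volume gains one more factor `r⁻¹` than surface. The chain rule compensates it in the gradient
  -- term, so only the zero-order term keeps `r⁻¹`.
  have hcr : ENNReal.ofReal ((r ^ (m + 1))⁻¹) = c * ENNReal.ofReal r⁻¹ := by
    rw [hc, ← ENNReal.ofReal_mul (by positivity), pow_succ, mul_inv]
  have e1 : ∀ x, ‖w x‖ₑ = ‖φ (r • x)‖ₑ ^ 2 := fun x => by rw [hw]; exact enorm_pow _ _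
  have i1 : ∫⁻ y in frontier P, ‖w y‖ₑ ∂(surface (m + 1))
      = c * ∫⁻ x in dilate r (frontier P), ‖φ x‖ₑ ^ 2 ∂(surface (m + 1)) := by
    simp_rw [e1]
    exact isHomogeneous_surface.setLIntegral hr (frontier P) fun x => ‖φ x‖ₑ ^ 2
  have i2 : ∫⁻ y in solid P, ‖w y‖ₑ
      = c * (ENNReal.ofReal r⁻¹ * ∫⁻ x in dilate r (solid P), ‖φ x‖ₑ ^ 2) := by
    simp_rw [e1]
    rw [← mul_assoc, ← hcr]
    exact isHomogeneous_volume.setLIntegral hr (solid P) fun x => ‖φ x‖ₑ ^ 2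
  have i3 : ∫⁻ y in solid P, ‖fderiv ℝ w y‖ₑ
      = c * ∫⁻ x in dilate r (solid P), 2 * (‖φ x‖ₑ * ‖fderiv ℝ φ x‖ₑ) := by
    simp_rw [hw, fderiv_sq_comp_smul hφ1]
    rw [lintegral_const_mul' _ _ enorm_ne_top,
      isHomogeneous_volume.setLIntegral hr (solid P) fun x => 2 * (‖φ x‖ₑ * ‖fderiv ℝ φ x‖ₑ),
      hcr, ← mul_assoc, mul_left_comm, Real.enorm_of_nonneg hr.le,
      ← ENNReal.ofReal_mul hr.le, mul_inv_cancel₀ hr.ne', ENNReal.ofReal_one, mul_one]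
  refine ⟨?_, fun α hα hαm hα0 => ?_⟩
  · rw [i1, i2, i3, ← mul_add, mul_left_comm] at h1
    exact (ENNReal.mul_le_mul_iff_right hc0 hct).1 h1
  · have h3 := h2 α hα hαm hα0
    have i4 : ∫ y in frontier P, α y * w y ∂(surface (m + 1)) = (r ^ m)⁻¹ *
        ∫ x in dilate r (frontier P), α (r⁻¹ • x) * φ x ^ 2 ∂(surface (m + 1)) := by
      have := isHomogeneous_surface.setIntegral hr (frontier P)
        fun x => α (r⁻¹ • x) * φ x ^ 2
      simpa [smul_smul, hr.ne'] using this
    rw [i4, i3, enorm_mul, Real.enorm_of_nonneg (by positivity), ← hc,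
      mul_left_comm (eLpNorm α ⊤ (holeSurface P)), mul_left_comm C] at h3
    exact (ENNReal.mul_le_mul_iff_right hc0 hct).1 h3

theorem two_mul_mul_le_young {s : ℝ} (hs : 0 < s) (a b : ℝ≥0∞) :
    2 * (a * b) ≤ ENNReal.ofReal s * a ^ 2 + ENNReal.ofReal s⁻¹ * b ^ 2 := by
  have hs0 : ENNReal.ofReal s ≠ 0 := by simpa using hs
  have hs1 : ENNReal.ofReal s⁻¹ ≠ 0 := by simpa using hs
  rcases eq_or_ne a ⊤ with rfl | ha
  · simp [ENNReal.mul_top hs0]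
  rcases eq_or_ne b ⊤ with rfl | hb
  · simp [ENNReal.mul_top hs1]
  lift a to ℝ≥0 using ha
  lift b to ℝ≥0 using hb
  rw [ENNReal.ofReal, ENNReal.ofReal]
  norm_cast
  rw [← NNReal.coe_le_coe]
  push_cast
  rw [Real.coe_toNNReal _ hs.le, Real.coe_toNNReal _ (inv_nonneg.2 hs.le)]
  have h : s * (a : ℝ) ^ 2 + s⁻¹ * (b : ℝ) ^ 2 - 2 * (a * b) = s⁻¹ * (s * a - b) ^ 2 := by
    field_simp
    ring
  have : 0 ≤ s⁻¹ * (s * a - b) ^ 2 := by positivity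
  linarith

theorem enorm_gradient (φ : Space (m + 1) → ℝ) (x : Space (m + 1)) :
    ‖gradient φ x‖ₑ = ‖fderiv ℝ φ x‖ₑ := by
  rw [gradient, ← ofReal_norm, LinearIsometryEquiv.norm_map, ofReal_norm]

/-- Test functions of `Ω` extended by zero see the whole dilated structure, which makes the
constants independent of `Ω`. -/
theorem setLIntegral_perforated {Ω : Set (Space (m + 1))} {r : ℝ} (Q : Set (Space (m + 1)))
    (ν : Measure (Space (m + 1))) (hΩ : MeasurableSet Ω) {F : Space (m + 1) → ℝ≥0∞}
    (hF : ∀ x ∉ Ω, F x = 0) :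
    ∫⁻ x in Ω ∩ dilate r Q, F x ∂ν = ∫⁻ x in dilate r Q, F x ∂ν := by
  rw [← setLIntegral_indicator hΩ]
  refine lintegral_congr fun x => ?_
  by_cases hx : x ∈ Ω
  · rw [indicator_of_mem hx]
  · rw [indicator_of_notMem hx, hF x hx]

end Test

/-! ### Passage to the limit in quadratic expressions -/

section LTwo

variable {X E : Type*} [MeasurableSpace X] {μ : Measure X} [NormedAddCommGroup E]

theorem eLpNorm_two_sq (f : X → E) (μ : Measure X) :
    eLpNorm f 2 μ ^ 2 = ∫⁻ x, ‖f x‖ₑ ^ 2 ∂μ := by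
  have := eLpNorm_nnreal_pow_eq_lintegral (f := f) (μ := μ) (p := 2) (by norm_num)
  simpa using this

theorem ofReal_integral_norm_sq {f : X → E} (hf : MemLp f 2 μ) :
    ENNReal.ofReal (∫ x, ‖f x‖ ^ 2 ∂μ) = eLpNorm f 2 μ ^ 2 := by
  rw [eLpNorm_two_sq, ofReal_integral_eq_lintegral_ofReal (hf.integrable_norm_pow (p := 2) two_ne_zero)
    (ae_of_all _ fun x => by positivity)]
  refine lintegral_congr fun x => ?_
  rw [ENNReal.ofReal_pow (norm_nonneg _), ofReal_norm]

theorem tendsto_eLpNorm_two {f : ℕ → X → E} {g : X → E} (hf : ∀ k, MemLp (f k) 2 μ)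
    (hg : MemLp g 2 μ) (h : Tendsto (fun k => eLpNorm (fun x => f k x - g x) 2 μ) atTop (𝓝 0)) :
    Tendsto (fun k => eLpNorm (f k) 2 μ ^ 2) atTop (𝓝 (eLpNorm g 2 μ ^ 2)) := by
  have h1 := ((Lp.tendsto_Lp_iff_tendsto_eLpNorm'' f hf g hg).2 h).enorm
  simp_rw [Lp.enorm_toLp] at h1
  exact ((ENNReal.continuous_pow 2).tendsto _).comp h1

/-- The integral is the `L²` inner product of `f` and `β f`, and multiplication by the bounded `β`
is continuous on `L²`. -/
theorem tendsto_integral_mul_sq {f : ℕ → X → ℝ} {g β : X → ℝ} (hf : ∀ k, MemLp (f k) 2 μ)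
    (hg : MemLp g 2 μ) (h : Tendsto (fun k => eLpNorm (fun x => f k x - g x) 2 μ) atTop (𝓝 0))
    (hβm : AEStronglyMeasurable β μ) {c : ℝ≥0∞} (hc : c ≠ ⊤) (hβ : ∀ᵐ x ∂μ, ‖β x‖ₑ ≤ c) :
    Tendsto (fun k => ∫ x, β x * f k x ^ 2 ∂μ) atTop (𝓝 (∫ x, β x * g x ^ 2 ∂μ)) := by
  have hle : ∀ u : X → ℝ, eLpNorm (fun x => β x * u x) 2 μ ≤ c * eLpNorm u 2 μ := fun u => by
    lift c to ℝ≥0 using hc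
    refine eLpNorm_le_nnreal_smul_eLpNorm_of_ae_le_mul ?_ 2
    filter_upwards [hβ] with x hx
    rw [nnnorm_mul]
    gcongr
    exact_mod_cast hx
  have hmem : ∀ u : X → ℝ, MemLp u 2 μ → MemLp (fun x => β x * u x) 2 μ := fun u hu =>
    ⟨hβm.mul hu.1, (hle u).trans_lt (ENNReal.mul_lt_top hc.lt_top hu.2)⟩
  have h1 := (Lp.tendsto_Lp_iff_tendsto_eLpNorm'' f hf g hg).2 h
  have h2 := (Lp.tendsto_Lp_iff_tendsto_eLpNorm'' (fun k x => β x * f k x) (fun k => hmem _ (hf k))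
    (fun x => β x * g x) (hmem _ hg)).2 (by
      have h3 : Tendsto (fun k => c * eLpNorm (fun x => f k x - g x) 2 μ) atTop (𝓝 0) := by
        simpa using ENNReal.Tendsto.const_mul h (Or.inr hc)
      refine tendsto_of_tendsto_of_tendsto_of_le_of_le tendsto_const_nhds h3 (fun _ => zero_le)
        fun k => ?_
      refine le_trans (le_of_eq ?_) (hle fun x => f k x - g x)
      congr 1
      ext x
      simp [mul_sub])
  have h4 := h1.inner (𝕜 := ℝ) h2
  have h5 : ∀ (u : X → ℝ) (hu : MemLp u 2 μ), inner ℝ (hu.toLp u) ((hmem u hu).toLp _)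
      = ∫ x, β x * u x ^ 2 ∂μ := fun u hu => by
    rw [L2.inner_def]
    refine integral_congr_ae ?_
    filter_upwards [hu.coeFn_toLp, (hmem u hu).coeFn_toLp] with x hx1 hx2
    rw [hx1, hx2]
    simp only [RCLike.inner_apply, conj_trivial]
    ring
  simpa only [h5] using h4

end LTwo

/-! ### Both estimates for test functions -/

section TestBound

variable {m : ℕ} {P : Set (Space (m + 1))}

theorem IsTestFunction.contDiff_one {n : ℕ} {Ω : Set (Space n)} {φ : Space n → ℝ}
    (h : IsTestFunction Ω φ) : ContDiff ℝ 1 φ := h.1.of_le (by exact_mod_cast le_top)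

theorem continuous_gradient {n : ℕ} {φ : Space n → ℝ} (h : ContDiff ℝ 1 φ) :
    Continuous (gradient φ) :=
  (LinearIsometryEquiv.continuous _).comp (h.continuous_fderiv (by simp))

theorem exists_test_bound (hP : IsPeriodicSet P) (hPs : HasSmoothBoundary P)
    (hconn : IsConnected (toTorus '' solid P)) :
    ∃ C : ℝ, 0 < C ∧ ∀ (Ω : Set (Space (m + 1))), IsOpen Ω → ∀ φ, IsTestFunction Ω φ →
      ∀ ε : ℝ, 0 < ε →
      (∀ δ : ℝ, 0 < δ → δ ≤ 1 →
        eLpNorm φ 2 ((surface (m + 1)).restrict (holeBoundary Ω P ε)) ^ 2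
          ≤ ENNReal.ofReal C *
            (ENNReal.ofReal (δ * ε)⁻¹ * eLpNorm φ 2 (volume.restrict (perforated Ω P ε)) ^ 2
            + ENNReal.ofReal (δ * ε)
              * eLpNorm (gradient φ) 2 (volume.restrict (perforated Ω P ε)) ^ 2)) ∧
      ∀ s : ℝ, 0 < s →
      ∀ α : Space (m + 1) → ℝ, IsPeriodicOn α (frontier P) → MemLp α ⊤ (holeSurface P) →
        ∫ y, α y ∂(holeSurface P) = 0 →
        ‖∫ x in holeBoundary Ω P ε, α (ε⁻¹ • x) * φ x ^ 2 ∂(surface (m + 1))‖ₑ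
          ≤ ENNReal.ofReal C * (eLpNorm α ⊤ (holeSurface P) *
            (ENNReal.ofReal s * eLpNorm φ 2 (volume.restrict (perforated Ω P ε)) ^ 2
            + ENNReal.ofReal s⁻¹
              * eLpNorm (gradient φ) 2 (volume.restrict (perforated Ω P ε)) ^ 2)) := by
  obtain ⟨C, hC, h⟩ := exists_scaled_bound hP hPs hconn
  -- The trace bound needs `2 * C`, since the zero-order term occurs once directly and once through
  -- Young's inequality; adding 1 ensures positivity.
  refine ⟨2 * C.toReal + 1, by positivity, fun Ω hΩ φ hφ ε hε => ?_⟩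
  obtain ⟨h1, h2⟩ := h φ hφ.2.1 hφ.contDiff_one ε hε
  have hC2 : 2 * C ≤ ENNReal.ofReal (2 * C.toReal + 1) := by
    rw [ENNReal.ofReal_add (by positivity) zero_le_one, ENNReal.ofReal_mul zero_le_two,
      ENNReal.ofReal_toReal hC]
    simp
  have hC1 : C ≤ ENNReal.ofReal (2 * C.toReal + 1) :=
    le_trans (by rw [two_mul]; exact le_self_add) hC2
  have z1 : ∀ x ∉ Ω, φ x = 0 := fun x hx =>
    image_eq_zero_of_notMem_tsupport fun h => hx (hφ.2.2 h)
  have z2 : ∀ x ∉ Ω, fderiv ℝ φ x = 0 := fun x hx =>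
    image_eq_zero_of_notMem_tsupport fun h => hx (hφ.2.2 (tsupport_fderiv_subset ℝ h))
  have n1 : eLpNorm φ 2 (volume.restrict (perforated Ω P ε)) ^ 2
      = ∫⁻ x in dilate ε (solid P), ‖φ x‖ₑ ^ 2 := by
    rw [eLpNorm_two_sq]
    exact setLIntegral_perforated (F := fun x => ‖φ x‖ₑ ^ 2) (solid P) volume
      hΩ.measurableSet fun x hx => by simp [z1 x hx]
  have n2 : eLpNorm (gradient φ) 2 (volume.restrict (perforated Ω P ε)) ^ 2
      = ∫⁻ x in dilate ε (solid P), ‖fderiv ℝ φ x‖ₑ ^ 2 := by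
    rw [eLpNorm_two_sq]
    simp_rw [enorm_gradient]
    exact setLIntegral_perforated (F := fun x => ‖fderiv ℝ φ x‖ₑ ^ 2) (solid P) volume
      hΩ.measurableSet fun x hx => by rw [← ofReal_norm, z2 x hx, norm_zero]; simp
  have n3 : eLpNorm φ 2 ((surface (m + 1)).restrict (holeBoundary Ω P ε)) ^ 2
      = ∫⁻ x in dilate ε (frontier P), ‖φ x‖ₑ ^ 2 ∂(surface (m + 1)) := by
    rw [eLpNorm_two_sq]
    exact setLIntegral_perforated (F := fun x => ‖φ x‖ₑ ^ 2) (frontier P) _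
      hΩ.measurableSet fun x hx => by simp [z1 x hx]
  have hmeas : Measurable fun x => ‖φ x‖ₑ ^ 2 := hφ.1.continuous.enorm.measurable.pow_const 2
  have young : ∀ s : ℝ, 0 < s →
      ∫⁻ x in dilate ε (solid P), 2 * (‖φ x‖ₑ * ‖fderiv ℝ φ x‖ₑ)
        ≤ ENNReal.ofReal s * (∫⁻ x in dilate ε (solid P), ‖φ x‖ₑ ^ 2)
          + ENNReal.ofReal s⁻¹ * ∫⁻ x in dilate ε (solid P), ‖fderiv ℝ φ x‖ₑ ^ 2 := by
    intro s hs
    rw [← lintegral_const_mul' _ _ ENNReal.ofReal_ne_top,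
      ← lintegral_const_mul' _ _ ENNReal.ofReal_ne_top,
      ← lintegral_add_left (hmeas.const_mul _)]
    exact lintegral_mono fun x => two_mul_mul_le_young hs _ _
  refine ⟨fun δ hδ hδ1 => ?_, fun s hs α hα hαm hα0 => ?_⟩
  · rw [n1, n2, n3]
    -- Young's inequality is used with parameter `(δ * ε)⁻¹`; `δ ≤ 1` lets `ε⁻¹` be replaced by `(δ
    -- * ε)⁻¹`.
    have hδε : 0 < (δ * ε)⁻¹ := by positivity
    have h3 := young _ hδε
    rw [inv_inv] at h3
    have h4 : ENNReal.ofReal ε⁻¹ ≤ ENNReal.ofReal (δ * ε)⁻¹ := by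
      refine ENNReal.ofReal_le_ofReal (inv_anti₀ (by positivity) ?_)
      exact mul_le_of_le_one_left hε.le hδ1
    refine h1.trans ((mul_le_mul_right (add_le_add (mul_le_mul_left h4 _) h3) _).trans ?_)
    refine le_trans ?_ (mul_le_mul_left hC2 _)
    rw [mul_comm 2 C, mul_assoc, two_mul]
    exact mul_le_mul_right (add_le_add le_self_add le_rfl) _
  · rw [n1, n2]
    have h3 : ∫ x in holeBoundary Ω P ε, α (ε⁻¹ • x) * φ x ^ 2 ∂(surface (m + 1))
        = ∫ x in dilate ε (frontier P), α (ε⁻¹ • x) * φ x ^ 2 ∂(surface (m + 1)) := by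
      refine (setIntegral_eq_of_subset_of_forall_sdiff_eq_zero
        (measurableSet_dilate isClosed_frontier.measurableSet) (fun x hx => hx.2)
        fun x hx => ?_).symm
      rw [z1 x fun h => hx.2 ⟨h, hx.1⟩]
      simp
    rw [h3]
    exact (h2 α hα hαm hα0).trans (mul_le_mul' hC1 (mul_le_mul_right (young s hs) _))

end TestBound

/-! ### Traces on `V_ε` and extension of the estimates by density -/

section Trace

variable {m : ℕ} {P Ω : Set (Space (m + 1))}

theorem IsTestFunction.memLp {φ : Space (m + 1) → ℝ} (h : IsTestFunction Ω φ)
    (U : Set (Space (m + 1))) : MemLp φ 2 (volume.restrict U) :=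
  (h.1.continuous.memLp_of_hasCompactSupport h.2.1).restrict _

theorem IsTestFunction.memLp_gradient {φ : Space (m + 1) → ℝ} (h : IsTestFunction Ω φ)
    (U : Set (Space (m + 1))) : MemLp (gradient φ) 2 (volume.restrict U) := by
  refine MemLp.restrict _ ((continuous_gradient h.contDiff_one).memLp_of_hasCompactSupport ?_)
  exact (h.2.1.fderiv ℝ).comp_left (map_zero _)

theorem IsTestFunction.sub {φ ψ : Space (m + 1) → ℝ} (h : IsTestFunction Ω φ)
    (h' : IsTestFunction Ω ψ) : IsTestFunction Ω (φ - ψ) :=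
  ⟨h.1.sub h'.1, h.2.1.sub h'.2.1, (tsupport_sub φ ψ).trans (union_subset h.2.2 h'.2.2)⟩

theorem IsTestFunction.gradient_sub {φ ψ : Space (m + 1) → ℝ} (h : IsTestFunction Ω φ)
    (h' : IsTestFunction Ω ψ) : gradient (φ - ψ) = gradient φ - gradient ψ := by
  ext1 x
  rw [Pi.sub_apply, gradient, gradient, gradient, fderiv_sub
    (h.contDiff_one.differentiable (by simp) x) (h'.contDiff_one.differentiable (by simp) x),
    map_sub]

theorem MemH1.memLp_weakGrad {n : ℕ} {U : Set (Space n)} {v : Space n → ℝ} (h : MemH1 U v) :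
    MemLp (weakGrad U v) 2 (volume.restrict U) := by
  rw [weakGrad, dif_pos h.2]
  exact h.2.choose_spec.1

/-- The distance of the test function `φ` from `v` in `H¹(Ω_ε)`. -/
noncomputable def h1Dist (Ω P : Set (Space (m + 1))) (ε : ℝ) (φ v : Space (m + 1) → ℝ) : ℝ≥0∞ :=
  eLpNorm (fun x => φ x - v x) 2 (volume.restrict (perforated Ω P ε))
    + eLpNorm (fun x => gradient φ x - weakGrad (perforated Ω P ε) v x) 2
        (volume.restrict (perforated Ω P ε))

theorem Approximates.tendsto_h1Dist {ε : ℝ} {φ : ℕ → Space (m + 1) → ℝ}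
    {v : Space (m + 1) → ℝ} (h : Approximates Ω (perforated Ω P ε) φ v) :
    Tendsto (fun k => h1Dist Ω P ε (φ k) v) atTop (𝓝 0) := by
  simpa [h1Dist] using h.2.1.add h.2.2

/-- The bound for test functions that makes the trace operator continuous. -/
theorem exists_trace_sub_le (hP : IsPeriodicSet P) (hPs : HasSmoothBoundary P)
    (hconn : IsConnected (toTorus '' solid P)) (hΩ : IsOpen Ω) {ε : ℝ} (hε : 0 < ε) :
    ∃ K : ℝ≥0∞, K ≠ ⊤ ∧
      (∀ φ, IsTestFunction Ω φ →
        MemLp φ 2 ((surface (m + 1)).restrict (holeBoundary Ω P ε))) ∧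
      ∀ v, MemH1 (perforated Ω P ε) v → ∀ φ ψ, IsTestFunction Ω φ → IsTestFunction Ω ψ →
        eLpNorm (φ - ψ) 2 ((surface (m + 1)).restrict (holeBoundary Ω P ε))
          ≤ K * (h1Dist Ω P ε φ v + h1Dist Ω P ε ψ v) := by
  obtain ⟨C, hC, h⟩ := exists_test_bound hP hPs hconn
  set ν := (volume : Measure (Space (m + 1))).restrict (perforated Ω P ε) with hν
  set σ := (surface (m + 1)).restrict (holeBoundary Ω P ε) with hσ
  set a := ENNReal.ofReal C * ENNReal.ofReal ε⁻¹ with ha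
  set b := ENNReal.ofReal C * ENNReal.ofReal ε with hb
  have hat : a ≠ ⊤ := ENNReal.mul_ne_top ENNReal.ofReal_ne_top ENNReal.ofReal_ne_top
  have hbt : b ≠ ⊤ := ENNReal.mul_ne_top ENNReal.ofReal_ne_top ENNReal.ofReal_ne_top
  -- The summand 1 gives `K ≤ K ^ 2`, so `K ^ 2` dominates both coefficients and the square can be
  -- removed.
  set K := a + b + 1 with hK
  have hKt : K ≠ ⊤ := by simp [hK, hat, hbt]
  have hK1 : K ≤ K ^ 2 := by
    rw [pow_two]
    exact le_mul_of_one_le_left zero_le le_add_self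
  have hle : ∀ φ, IsTestFunction Ω φ →
      eLpNorm φ 2 σ ≤ K * (eLpNorm φ 2 ν + eLpNorm (gradient φ) 2 ν) := by
    intro φ hφ
    have h1 := (h Ω hΩ φ hφ ε hε).1 1 one_pos le_rfl
    rw [one_mul, mul_add, ← mul_assoc, ← mul_assoc, ← ha, ← hb] at h1
    refine (ENNReal.pow_le_pow_left_iff two_ne_zero).1 (h1.trans ?_)
    rw [mul_pow]
    calc a * eLpNorm φ 2 ν ^ 2 + b * eLpNorm (gradient φ) 2 ν ^ 2
        ≤ K ^ 2 * eLpNorm φ 2 ν ^ 2 + K ^ 2 * eLpNorm (gradient φ) 2 ν ^ 2 := by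
          refine add_le_add (mul_le_mul_left (le_trans ?_ hK1) _)
            (mul_le_mul_left (le_trans ?_ hK1) _)
          · rw [hK, add_assoc]; exact le_self_add
          · rw [hK, add_comm a, add_assoc]; exact le_self_add
      _ = K ^ 2 * (eLpNorm φ 2 ν ^ 2 + eLpNorm (gradient φ) 2 ν ^ 2) := by ring
      _ ≤ _ := by
          refine mul_le_mul_right ?_ _
          rw [add_sq]
          refine add_le_add ?_ le_rfl
          exact le_self_add
  refine ⟨K, hKt, fun φ hφ => ⟨hφ.1.continuous.aestronglyMeasurable, (hle φ hφ).trans_lt ?_⟩,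
    fun v hv φ ψ hφ hψ => (hle _ (hφ.sub hψ)).trans (mul_le_mul_right ?_ _)⟩
  · exact ENNReal.mul_lt_top hKt.lt_top
      (ENNReal.add_lt_top.2 ⟨(hφ.memLp _).2, (hφ.memLp_gradient _).2⟩)
  · have h1 : eLpNorm (φ - ψ) 2 ν
        ≤ eLpNorm (fun x => φ x - v x) 2 ν + eLpNorm (fun x => ψ x - v x) 2 ν := by
      have : φ - ψ = (fun x => φ x - v x) - fun x => ψ x - v x := by ext x; simp
      rw [this]
      exact eLpNorm_sub_le ((hφ.memLp _).sub hv.1).1 ((hψ.memLp _).sub hv.1).1 (by norm_num)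
    have h2 : eLpNorm (gradient (φ - ψ)) 2 ν
        ≤ eLpNorm (fun x => gradient φ x - weakGrad (perforated Ω P ε) v x) 2 ν
          + eLpNorm (fun x => gradient ψ x - weakGrad (perforated Ω P ε) v x) 2 ν := by
      have : gradient (φ - ψ) = (fun x => gradient φ x - weakGrad (perforated Ω P ε) v x)
          - fun x => gradient ψ x - weakGrad (perforated Ω P ε) v x := by
        rw [hφ.gradient_sub hψ]; ext1 x; simp
      rw [this]
      exact eLpNorm_sub_le ((hφ.memLp_gradient _).sub hv.memLp_weakGrad).1
        ((hψ.memLp_gradient _).sub hv.memLp_weakGrad).1 (by norm_num)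
    refine (add_le_add h1 h2).trans (le_of_eq ?_)
    unfold h1Dist
    ring

/-- The trace estimate makes the restrictions of an approximating sequence Cauchy in `L²` of the
surface, and completeness provides the limit. -/
theorem exists_isTrace (hP : IsPeriodicSet P) (hPs : HasSmoothBoundary P)
    (hconn : IsConnected (toTorus '' solid P)) (hΩ : IsOpen Ω) {ε : ℝ} (hε : 0 < ε)
    {v : Space (m + 1) → ℝ} (hv : MemV Ω P ε v) : ∃ g, IsTrace Ω P ε v g := by
  obtain ⟨hv1, φ, hφ⟩ := hv
  obtain ⟨K, hK, hmem, hle⟩ := exists_trace_sub_le hP hPs hconn hΩ hε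
  set σ := (surface (m + 1)).restrict (holeBoundary Ω P ε)
  have htend : ∀ ψ : ℕ → Space (m + 1) → ℝ, Approximates Ω (perforated Ω P ε) ψ v →
      Tendsto (fun k => K * h1Dist Ω P ε (ψ k) v) atTop (𝓝 0) := fun ψ hψ => by
    simpa using ENNReal.Tendsto.const_mul hψ.tendsto_h1Dist (Or.inr hK)
  set u : ℕ → Lp ℝ 2 σ := fun k => (hmem _ (hφ.1 k)).toLp (φ k)
  have hcau : CauchySeq u := by
    refine EMetric.cauchySeq_iff.2 fun η hη => ?_
    have hη2 : (0 : ℝ≥0∞) < η / 2 := ENNReal.half_pos hη.ne'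
    obtain ⟨N, hN⟩ := eventually_atTop.1 ((htend φ hφ).eventually_lt_const hη2)
    refine ⟨N, fun k hk l hl => ?_⟩
    rw [Lp.edist_toLp_toLp]
    refine (hle v hv1 _ _ (hφ.1 k) (hφ.1 l)).trans_lt ?_
    rw [mul_add, ← ENNReal.add_halves η]
    exact ENNReal.add_lt_add (hN k hk) (hN l hl)
  obtain ⟨G, hG⟩ := cauchySeq_tendsto_of_complete hcau
  set g : Space (m + 1) → ℝ := ⇑G
  have hgm : MemLp g 2 σ := Lp.memLp G
  have hg' : Tendsto (fun k => eLpNorm (φ k - g) 2 σ) atTop (𝓝 0) := by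
    refine (Lp.tendsto_Lp_iff_tendsto_eLpNorm'' φ (fun k => hmem _ (hφ.1 k)) g hgm).1 ?_
    rwa [Lp.toLp_coeFn]
  refine ⟨g, hgm, fun ψ hψ => ?_⟩
  -- Any other approximating sequence has the same limit, because the bound compares two arbitrary
  -- test functions.
  have hsum : Tendsto (fun k => (K * h1Dist Ω P ε (ψ k) v + K * h1Dist Ω P ε (φ k) v)
      + eLpNorm (φ k - g) 2 σ) atTop (𝓝 0) := by
    simpa using ((htend ψ hψ).add (htend φ hφ)).add hg'
  refine tendsto_of_tendsto_of_tendsto_of_le_of_le tendsto_const_nhds hsum (fun _ => zero_le)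
    fun k => ?_
  have h1 : (fun x => ψ k x - g x) = (ψ k - φ k) + (φ k - g) := by ext x; simp
  change eLpNorm (fun x => ψ k x - g x) 2 σ ≤ _
  rw [h1, ← mul_add]
  refine (eLpNorm_add_le ((hmem _ (hψ.1 k)).sub (hmem _ (hφ.1 k))).1
    ((hmem _ (hφ.1 k)).sub hgm).1 (by norm_num)).trans ?_
  exact add_le_add (hle v hv1 _ _ (hψ.1 k) (hφ.1 k)) le_rfl

theorem isTrace_trace (hP : IsPeriodicSet P) (hPs : HasSmoothBoundary P)
    (hconn : IsConnected (toTorus '' solid P)) (hΩ : IsOpen Ω) {ε : ℝ} (hε : 0 < ε)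
    {v : Space (m + 1) → ℝ} (hv : MemV Ω P ε v) : IsTrace Ω P ε v (trace Ω P ε v) := by
  have h := exists_isTrace hP hPs hconn hΩ hε hv
  rw [trace, dif_pos h]
  exact h.choose_spec

/-- The trace inequality on `V_ε`, and the bound on `V_ε` for the boundary term of the Robin
form. -/
theorem exists_trace_bound (hP : IsPeriodicSet P) (hPs : HasSmoothBoundary P)
    (hconn : IsConnected (toTorus '' solid P)) :
    ∃ C : ℝ, 0 < C ∧ ∀ (Ω : Set (Space (m + 1))), IsOpen Ω → ∀ ε : ℝ, 0 < ε →
      ∀ v, MemV Ω P ε v →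
      (∀ δ : ℝ, 0 < δ → δ ≤ 1 → traceNormSq Ω P ε v
        ≤ C * ((δ * ε)⁻¹ * normSq Ω P ε v + (δ * ε) * gradNormSq Ω P ε v)) ∧
      ∀ s : ℝ, 0 < s →
      ∀ α : Space (m + 1) → ℝ, IsPeriodicOn α (frontier P) → MemLp α ⊤ (holeSurface P) →
        ∫ y, α y ∂(holeSurface P) = 0 →
        |∫ x in holeBoundary Ω P ε, α (ε⁻¹ • x) * trace Ω P ε v x ^ 2 ∂(surface (m + 1))|
          ≤ C * (supNorm P α * (s * normSq Ω P ε v + s⁻¹ * gradNormSq Ω P ε v)) := by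
  obtain ⟨C, hC, h⟩ := exists_test_bound hP hPs hconn
  refine ⟨C, hC, fun Ω hΩ ε hε v hv => ?_⟩
  have htr := isTrace_trace hP hPs hconn hΩ hε hv
  obtain ⟨K, -, hmem, -⟩ := exists_trace_sub_le hP hPs hconn hΩ hε
  obtain ⟨hv1, φ, hφ⟩ := hv
  have hgr := hv1.memLp_weakGrad
  have t1 := tendsto_eLpNorm_two (fun k => (hφ.1 k).memLp _) hv1.1 hφ.2.1
  have t2 := tendsto_eLpNorm_two (fun k => (hφ.1 k).memLp_gradient _) hgr hφ.2.2
  have t3 := tendsto_eLpNorm_two (fun k => hmem _ (hφ.1 k)) htr.1 (htr.2 φ hφ)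
  have n1 : ENNReal.ofReal (normSq Ω P ε v)
      = eLpNorm v 2 (volume.restrict (perforated Ω P ε)) ^ 2 := by
    simpa only [Real.norm_eq_abs, sq_abs, normSq, traceNormSq] using ofReal_integral_norm_sq hv1.1
  have n2 : ENNReal.ofReal (gradNormSq Ω P ε v)
      = eLpNorm (weakGrad (perforated Ω P ε) v) 2 (volume.restrict (perforated Ω P ε)) ^ 2 :=
    ofReal_integral_norm_sq hgr
  have n3 : ENNReal.ofReal (traceNormSq Ω P ε v)
      = eLpNorm (trace Ω P ε v) 2
          ((surface (m + 1)).restrict (holeBoundary Ω P ε)) ^ 2 := by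
    simpa only [Real.norm_eq_abs, sq_abs, normSq, traceNormSq] using ofReal_integral_norm_sq htr.1
  rw [← n1] at t1
  rw [← n2] at t2
  rw [← n3] at t3
  have p1 : 0 ≤ normSq Ω P ε v := integral_nonneg fun x => sq_nonneg _
  have p2 : 0 ≤ gradNormSq Ω P ε v := integral_nonneg fun x => sq_nonneg _
  have comb : ∀ a b : ℝ, Tendsto (fun k =>
      ENNReal.ofReal a * eLpNorm (φ k) 2 (volume.restrict (perforated Ω P ε)) ^ 2
        + ENNReal.ofReal b * eLpNorm (gradient (φ k)) 2
            (volume.restrict (perforated Ω P ε)) ^ 2) atTop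
      (𝓝 (ENNReal.ofReal a * ENNReal.ofReal (normSq Ω P ε v)
        + ENNReal.ofReal b * ENNReal.ofReal (gradNormSq Ω P ε v))) := fun a b =>
    (ENNReal.Tendsto.const_mul t1 (Or.inr ENNReal.ofReal_ne_top)).add
      (ENNReal.Tendsto.const_mul t2 (Or.inr ENNReal.ofReal_ne_top))
  have merge : ∀ a b : ℝ, 0 < a → 0 < b →
      ENNReal.ofReal a * ENNReal.ofReal (normSq Ω P ε v)
        + ENNReal.ofReal b * ENNReal.ofReal (gradNormSq Ω P ε v)
      = ENNReal.ofReal (a * normSq Ω P ε v + b * gradNormSq Ω P ε v) := fun a b ha hb => by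
    rw [← ENNReal.ofReal_mul ha.le, ← ENNReal.ofReal_mul hb.le,
      ← ENNReal.ofReal_add (by positivity) (by positivity)]
  refine ⟨fun δ hδ hδ1 => ?_, fun s hs α hα hαm hα0 => ?_⟩
  · have hlim := le_of_tendsto_of_tendsto' t3
      (ENNReal.Tendsto.const_mul (comb (δ * ε)⁻¹ (δ * ε)) (Or.inr ENNReal.ofReal_ne_top))
      fun k => (h Ω hΩ _ (hφ.1 k) ε hε).1 δ hδ hδ1
    have hδε : 0 < δ * ε := mul_pos hδ hε
    rw [merge _ _ (inv_pos.2 hδε) hδε, ← ENNReal.ofReal_mul hC.le] at hlim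
    exact (ENNReal.ofReal_le_ofReal_iff (by positivity)).1 hlim
  · have hQ := isHomogeneous_surface.quasiMeasurePreserving hε (frontier P)
    have hsub : (surface (m + 1)).restrict (holeBoundary Ω P ε)
        ≤ (surface (m + 1)).restrict (dilate ε (frontier P)) :=
      Measure.restrict_mono_set _ fun x hx => hx.2
    have hαQ := intInvariant_surface.aestronglyMeasurable hP.frontier
      isClosed_frontier.measurableSet hα hαm.1
    have hβm := (hαQ.comp_quasiMeasurePreserving hQ).mono_measure hsub
    have hβ := ae_mono hsub (hQ.ae (ae_enorm_le_eLpNorm_top hP hα))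
    have t4 := (tendsto_integral_mul_sq (fun k => hmem _ (hφ.1 k)) htr.1 (htr.2 φ hφ) hβm
      hαm.2.ne hβ).enorm
    have hlim := le_of_tendsto_of_tendsto' t4
      (ENNReal.Tendsto.const_mul (ENNReal.Tendsto.const_mul (comb s s⁻¹) (Or.inr hαm.2.ne))
        (Or.inr ENNReal.ofReal_ne_top))
      fun k => (h Ω hΩ _ (hφ.1 k) ε hε).2 s hs α hα hαm hα0
    have ha : eLpNorm α ⊤ (holeSurface P) = ENNReal.ofReal (supNorm P α) :=
      (ENNReal.ofReal_toReal hαm.2.ne).symm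
    have ha0 : 0 ≤ supNorm P α := ENNReal.toReal_nonneg
    rw [merge _ _ hs (inv_pos.2 hs), ha, ← ENNReal.ofReal_mul ha0, ← ENNReal.ofReal_mul hC.le,
      Real.enorm_eq_ofReal_abs] at hlim
    exact (ENNReal.ofReal_le_ofReal_iff (by positivity)).1 hlim

end Trace

/-! ### Lower bounds for the two volume terms -/

section Coercive

variable {n : ℕ}

theorem measurableSet_perforated {Ω : Set (Space n)} (hΩ : IsOpen Ω) (P : Set (Space n)) (ε : ℝ) :
    MeasurableSet (perforated Ω P ε) :=
  hΩ.measurableSet.inter (measurableSet_dilate (r := ε) (isOpen_solid P).measurableSet)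

theorem quasiMeasurePreserving_inv_smul {ε : ℝ} (hε : 0 < ε) :
    Measure.QuasiMeasurePreserving (fun x : Space n => ε⁻¹ • x) volume volume := by
  simpa [dilate] using isHomogeneous_volume.quasiMeasurePreserving hε (univ : Set (Space n))

variable {Ω : Set (Space n)} {m M : ℝ} {A : Space n → Space n → Matrix (Fin n) (Fin n) ℝ}

theorem IsDiffusion.aemeasurable_section (hA : IsDiffusion Ω m M A) {x₀ : Space n}
    (hx₀ : x₀ ∈ Ω) {ε : ℝ} (hε : 0 < ε) (i j : Fin n) :
    AEMeasurable (fun x => A x₀ (ε⁻¹ • x) i j) := by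
  have h1 : IsPeriodicOn (fun y => A x₀ y i j) univ := fun y hy k =>
    congrFun (congrFun (hA.periodic x₀ hx₀ y hy k) i) j
  have h2 := intInvariant_volume.aestronglyMeasurable isPeriodicSet_univ MeasurableSet.univ h1
    (by rw [univ_inter]; exact (hA.memLp x₀ hx₀ i j).1)
  rw [Measure.restrict_univ] at h2
  exact (h2.comp_quasiMeasurePreserving (quasiMeasurePreserving_inv_smul hε)).aemeasurable

/-- `A x (ε⁻¹ • x)` is an a.e. limit of fields whose first argument is frozen on the pieces of a
countable partition. The null sets in `continuous` concern `y` only, so their preimages under the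
dilation are null. -/
theorem IsDiffusion.aemeasurable (hA : IsDiffusion Ω m M A) (hΩ : IsOpen Ω) {ε : ℝ}
    (hε : 0 < ε) (i j : Fin n) :
    AEMeasurable (fun x => A x (ε⁻¹ • x) i j) (volume.restrict Ω) := by
  rcases Ω.eq_empty_or_nonempty with rfl | hne
  · simp
  have hη : ∀ k : ℕ, (0 : ℝ) < 1 / (k + 1) := fun k => by positivity
  have hcover : ∀ k : ℕ, ∃ (c : ℕ → Space n) (r : ℕ → ℝ), (∀ l, c l ∈ Ω) ∧
      (∀ l, ∀ᵐ y ∂(volume : Measure (Space n)), ∀ x ∈ Ω, dist x (c l) < r l →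
        |A x y i j - A (c l) y i j| ≤ 1 / (k + 1)) ∧
      Ω ⊆ ⋃ l, Metric.ball (c l) (r l) := by
    intro k
    have h : ∀ x : Space n, ∃ r : ℝ, x ∈ Ω → 0 < r ∧ ∀ᵐ y ∂(volume : Measure (Space n)),
        ∀ z ∈ Ω, dist z x < r → |A z y i j - A x y i j| ≤ 1 / (k + 1) := fun x => by
      by_cases hx : x ∈ Ω
      · obtain ⟨r, hr, h⟩ := hA.continuous x hx _ (hη k)
        refine ⟨r, fun _ => ⟨hr, ?_⟩⟩
        filter_upwards [h] with y hy z hz hzx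
        exact hy z hz hzx i j
      · exact ⟨0, fun h => absurd h hx⟩
    choose r hr using h
    obtain ⟨t, htΩ, htc, ht⟩ := TopologicalSpace.countable_cover_nhdsWithin
      (f := fun x => Metric.ball x (r x)) (s := Ω)
      fun x hx => mem_nhdsWithin_of_mem_nhds (Metric.ball_mem_nhds x (hr x hx).1)
    have htne : t.Nonempty := by
      by_contra h
      rw [not_nonempty_iff_eq_empty] at h
      subst h
      obtain ⟨x, hx⟩ := hne
      simpa using ht hx
    obtain ⟨c, rfl⟩ := htc.exists_eq_range htne
    have hcΩ : ∀ l, c l ∈ Ω := fun l => htΩ (mem_range_self l)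
    refine ⟨c, fun l => r (c l), hcΩ, fun l => (hr _ (hcΩ l)).2, ?_⟩
    simpa using ht
  choose c r hcΩ hcr hcov using hcover
  -- Making the balls disjoint gives each point of `Ω` one well-defined centre `c k (J k x)` at
  -- precision `1 / (k + 1)`.
  set D : ℕ → ℕ → Set (Space n) := fun k => disjointed fun l => Metric.ball (c k l) (r k l)
  have hDm : ∀ k l, MeasurableSet (D k l) := fun k l =>
    MeasurableSet.disjointed (fun _ => measurableSet_ball) l
  have hDU : ∀ k, Ω ⊆ ⋃ l, D k l := fun k => by
    simpa only [D, iUnion_disjointed] using hcov k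
  have hJ : ∀ k x, ∃ l, x ∈ Ω → x ∈ D k l := fun k x => by
    by_cases hx : x ∈ Ω
    · obtain ⟨l, hl⟩ := mem_iUnion.1 (hDU k hx)
      exact ⟨l, fun _ => hl⟩
    · exact ⟨0, fun h => absurd h hx⟩
  choose J hJ using hJ
  have hJeq : ∀ k l x, x ∈ Ω → x ∈ D k l → J k x = l := fun k l x hx hl => by
    by_contra h
    exact disjoint_left.1 (disjoint_disjointed (fun l => Metric.ball (c k l) (r k l)) h)
      (hJ k x hx) hl
  refine aemeasurable_of_tendsto_metrizable_ae (f := fun k x => A (c k (J k x)) (ε⁻¹ • x) i j)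
    atTop (fun k => ?_) ?_
  · have hΩe : Ω = ⋃ l, Ω ∩ D k l := by
      rw [← inter_iUnion, inter_eq_left.2 (hDU k)]
    rw [hΩe, aemeasurable_iUnion_iff]
    intro l
    refine ((hA.aemeasurable_section (hcΩ k l) hε i j).restrict (s := Ω ∩ D k l)).congr ?_
    filter_upwards [ae_restrict_mem (hΩ.measurableSet.inter (hDm k l))] with x hx
    rw [hJeq k l x hx.1 hx.2]
  · have hall : ∀ᵐ y ∂(volume : Measure (Space n)), ∀ k l, ∀ x ∈ Ω, dist x (c k l) < r k l →
        |A x y i j - A (c k l) y i j| ≤ 1 / (k + 1) :=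
      ae_all_iff.2 fun k => ae_all_iff.2 fun l => hcr k l
    filter_upwards [ae_restrict_of_ae ((quasiMeasurePreserving_inv_smul hε).ae hall),
      ae_restrict_mem hΩ.measurableSet] with x hx hxΩ
    rw [tendsto_iff_dist_tendsto_zero]
    refine squeeze_zero (fun _ => dist_nonneg) (fun k => ?_)
      (tendsto_one_div_add_atTop_nhds_zero_nat (𝕜 := ℝ))
    rw [dist_comm, Real.dist_eq]
    refine hx k (J k x) x hxΩ ?_
    exact Metric.mem_ball.1 (disjointed_subset (fun l => Metric.ball (c k l) (r k l)) _
      (hJ k x hxΩ))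

/-- The upper bound `M` supplies integrability of the quadratic form; without it the Bochner
integral could default to zero. -/
theorem IsDiffusion.mul_integral_le (hA : IsDiffusion Ω m M A) (hm : 0 < m) (hΩ : IsOpen Ω)
    (P : Set (Space n)) {ε : ℝ} (hε : 0 < ε) {G : Space n → Space n}
    (hG : MemLp G 2 (volume.restrict (perforated Ω P ε))) :
    m * ∫ x in perforated Ω P ε, ‖G x‖ ^ 2
      ≤ ∫ x in perforated Ω P ε, matForm (A x (ε⁻¹ • x)) (G x) (G x) := by
  have hG2 : Integrable (fun x => ‖G x‖ ^ 2) (volume.restrict (perforated Ω P ε)) :=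
    hG.integrable_norm_pow (p := 2) two_ne_zero
  have hell : ∀ᵐ x ∂volume.restrict (perforated Ω P ε),
      m * ‖G x‖ ^ 2 ≤ matForm (A x (ε⁻¹ • x)) (G x) (G x) ∧
      matForm (A x (ε⁻¹ • x)) (G x) (G x) ≤ M * ‖G x‖ ^ 2 := by
    filter_upwards [ae_restrict_of_ae ((quasiMeasurePreserving_inv_smul hε).ae hA.elliptic),
      ae_restrict_mem (measurableSet_perforated hΩ P ε)] with x hx hxΩ
    exact hx x hxΩ.1 (G x)
  have hGi : ∀ i, AEMeasurable (fun x => G x i) (volume.restrict (perforated Ω P ε)) := fun i =>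
    (by fun_prop : Measurable fun y : Space n => y i).comp_aemeasurable hG.1.aemeasurable
  have hmeas : AEMeasurable (fun x => matForm (A x (ε⁻¹ • x)) (G x) (G x))
      (volume.restrict (perforated Ω P ε)) := by
    unfold matForm
    refine Finset.aemeasurable_fun_sum _ fun i _ => Finset.aemeasurable_fun_sum _ fun j _ => ?_
    exact (((hA.aemeasurable hΩ hε i j).mono_measure
      (Measure.restrict_mono_set _ fun x hx => hx.1)).mul (hGi j)).mul (hGi i)
  rw [← integral_const_mul]
  refine integral_mono_ae (hG2.const_mul m) ?_ (hell.mono fun x hx => hx.1)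
  refine (hG2.const_mul M).mono' hmeas.aestronglyMeasurable ?_
  filter_upwards [hell] with x hx
  rw [Real.norm_of_nonneg (le_trans (by positivity) hx.1)]
  exact hx.2

/-- The pointwise bounds on `μ` pass from one period to the dilated solid part; the `L^∞` bound
ensures integrability. -/
theorem mul_normSq_le {P : Set (Space n)} (hP : IsPeriodicSet P)
    {μ : Space n → ℝ} {μ₀ : ℝ} (hμ : IsPeriodicOn μ (solid P))
    (hμm : MemLp μ ⊤ (solidMeasure P)) (hμ₀ : ∀ᵐ y ∂(solidMeasure P), μ₀ ≤ μ y) {ε : ℝ}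
    (hε : 0 < ε) {v : Space n → ℝ} (hv : MemLp v 2 (volume.restrict (perforated Ω P ε))) :
    μ₀ * normSq Ω P ε v ≤ ∫ x in perforated Ω P ε, μ (ε⁻¹ • x) * v x * v x := by
  have hQ := hP.solid
  have hQm := (isOpen_solid P).measurableSet
  have hqm := isHomogeneous_volume.quasiMeasurePreserving hε (solid P)
  have hsub : (volume : Measure (Space n)).restrict (perforated Ω P ε)
      ≤ volume.restrict (dilate ε (solid P)) :=
    Measure.restrict_mono_set _ fun x hx => hx.2
  have h1 : ∀ᵐ x ∂volume.restrict (perforated Ω P ε), μ₀ ≤ μ (ε⁻¹ • x) :=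
    ae_mono hsub (hqm.ae (intInvariant_volume.ae_restrict hQ hQm
      (fun y hy k h => by rwa [hμ y hy k]) hμ₀))
  have h2 : ∀ᵐ x ∂volume.restrict (perforated Ω P ε),
      ‖μ (ε⁻¹ • x)‖ₑ ≤ eLpNorm μ ⊤ (solidMeasure P) :=
    ae_mono hsub (hqm.ae (intInvariant_volume.ae_restrict (p := fun y =>
      ‖μ y‖ₑ ≤ eLpNorm μ ⊤ (solidMeasure P)) hQ hQm (fun y hy k h => by rwa [hμ y hy k])
      (by rw [eLpNorm_exponent_top]; exact ae_le_eLpNormEssSup)))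
  have hmeas : AEStronglyMeasurable (fun x => μ (ε⁻¹ • x))
      (volume.restrict (perforated Ω P ε)) :=
    ((intInvariant_volume.aestronglyMeasurable hQ hQm hμ hμm.1).comp_quasiMeasurePreserving
      hqm).mono_measure hsub
  have hv2 : Integrable (fun x => v x ^ 2) (volume.restrict (perforated Ω P ε)) := hv.integrable_sq
  rw [normSq, ← integral_const_mul]
  refine integral_mono_ae (hv2.const_mul _) ?_ ?_
  · refine (hv2.const_mul (eLpNorm μ ⊤ (solidMeasure P)).toReal).mono'
      ((hmeas.mul hv.1).mul hv.1) ?_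
    filter_upwards [h2] with x hx
    rw [mul_assoc, norm_mul, ← sq, norm_pow, Real.norm_eq_abs (v x), sq_abs]
    gcongr
    rw [← toReal_enorm]
    exact ENNReal.toReal_mono hμm.2.ne hx
  · filter_upwards [h1] with x hx
    rw [mul_assoc, ← sq]
    gcongr

end Coercive

end Perforated

/-! ### The coercivity lemma -/

open Perforated
theorem mainTheorem6 (n : ℕ) (hn : 2 ≤ n)
    (P : Set (Space n)) (hPper : IsPeriodicSet P) (hPsmooth : HasSmoothBoundary P)
    (hconn : IsConnected (toTorus '' solid P)) :
    ∃ Cs : ℝ, 0 < Cs ∧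
      (∀ Ω : Set (Space n), IsConnected Ω → Bornology.IsBounded Ω → HasSmoothBoundary Ω →
        ∀ ε : ℝ, 0 < ε → ∀ v : Space n → ℝ, MemV Ω P ε v →
          (∃ g, IsTrace Ω P ε v g) ∧
          ∀ δ : ℝ, 0 < δ → δ ≤ 1 →
            traceNormSq Ω P ε v
              ≤ Cs * ((δ * ε)⁻¹ * normSq Ω P ε v + (δ * ε) * gradNormSq Ω P ε v)) ∧
      (∀ Ω : Set (Space n), IsConnected Ω → Bornology.IsBounded Ω → HasSmoothBoundary Ω →
        ∀ (m M μ₀ : ℝ), 0 < m → 0 < M → 0 < μ₀ →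
        ∀ A : Space n → Space n → Matrix (Fin n) (Fin n) ℝ, IsDiffusion Ω m M A →
        ∀ μ : Space n → ℝ, IsPeriodicOn μ (solid P) → MemLp μ ⊤ (solidMeasure P) →
          (∀ᵐ y ∂(solidMeasure P), μ₀ ≤ μ y) →
        ∀ α : Space n → ℝ, IsPeriodicOn α (frontier P) → MemLp α ⊤ (holeSurface P) →
          ∫ y, α y ∂(holeSurface P) = 0 →
        Cs * supNorm P α < Real.sqrt (μ₀ * m) →
          0 < (1 - Cs * supNorm P α / Real.sqrt (m * μ₀)) * min m μ₀ ∧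
          ∀ ε : ℝ, 0 < ε → ∀ v : Space n → ℝ, MemV Ω P ε v →
            (1 - Cs * supNorm P α / Real.sqrt (m * μ₀)) * min m μ₀
                * (gradNormSq Ω P ε v + normSq Ω P ε v)
              ≤ robinForm Ω P A μ α ε v v) := by
  obtain ⟨d, rfl⟩ : ∃ d, n = d + 1 := ⟨n - 1, by omega⟩
  obtain ⟨C, hC, h⟩ := exists_trace_bound hPper hPsmooth hconn
  refine ⟨C, hC, fun Ω _ _ hΩ ε hε v hv => ⟨exists_isTrace hPper hPsmooth hconn hΩ.1 hε hv,
    (h Ω hΩ.1 ε hε v hv).1⟩, ?_⟩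
  intro Ω _ _ hΩ m M μ₀ hm _ hμ₀ A hA μ hμ hμm hμμ₀ α hα hαm hα0 hlt
  set q := Real.sqrt (m * μ₀) with hq
  have hq0 : 0 < q := Real.sqrt_pos.2 (mul_pos hm hμ₀)
  have hqq : q * q = m * μ₀ := Real.mul_self_sqrt (mul_pos hm hμ₀).le
  rw [mul_comm μ₀ m, ← hq] at hlt
  have hθ : 0 < 1 - C * supNorm P α / q := sub_pos.2 ((div_lt_one hq0).2 hlt)
  refine ⟨mul_pos hθ (lt_min hm hμ₀), fun ε hε v hv => ?_⟩
  have b1 := hA.mul_integral_le hm hΩ.1 P hε hv.1.memLp_weakGrad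
  have b2 := mul_normSq_le hPper hμ hμm hμμ₀ hε hv.1.1
  -- With `s = μ₀ / q` and `q ^ 2 = m * μ₀` one has `s⁻¹ = m / q`, so the boundary term is at most
  -- `C * supNorm P α / q` times `μ₀ ‖v‖² + m ‖∇v‖²`, the lower bound of the volume terms.
  have b3 := (h Ω hΩ.1 ε hε v hv).2 (μ₀ / q) (by positivity) α hα hαm hα0
  have p1 : 0 ≤ normSq Ω P ε v := MeasureTheory.integral_nonneg fun x => sq_nonneg _
  have p2 : 0 ≤ gradNormSq Ω P ε v := MeasureTheory.integral_nonneg fun x => sq_nonneg _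
  change m * gradNormSq Ω P ε v ≤ _ at b1
  have b4 := (abs_le.1 b3).1
  have hs : (μ₀ / q)⁻¹ = m / q := by
    rw [inv_div, div_eq_div_iff hμ₀.ne' hq0.ne', hqq]
  rw [hs] at b4
  simp_rw [pow_two, ← mul_assoc] at b4
  unfold robinForm
  have e1 : C * supNorm P α * (μ₀ / q * normSq Ω P ε v + m / q * gradNormSq Ω P ε v)
      = C * supNorm P α / q * (μ₀ * normSq Ω P ε v + m * gradNormSq Ω P ε v) := by
    field_simp
  rw [e1] at b4
  have e2 : min m μ₀ * (gradNormSq Ω P ε v + normSq Ω P ε v)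
      ≤ m * gradNormSq Ω P ε v + μ₀ * normSq Ω P ε v := by
    rw [mul_add]
    gcongr
    · exact min_le_left _ _
    · exact min_le_right _ _
  have e3 := mul_le_mul_of_nonneg_left e2 hθ.le
  rw [mul_assoc]
  linarith
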